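/- Let $n\ge 1$, put $m=\lfloor n/2\rfloor$, and let $\mathbb k$ be a commutative ring with a chosen element $\sqrt n$ satisfying $(\sqrt n)^2=n$. **Ribbon graphs.** A trivalent ribbon graph $\Gamma$ (loops, multiple edges and vertexless edges allowed) is presented by a signed rotation system: a finite set of half-edges, three at each vertex $v\in V$, a cyclic order of the half-edges at each vertex, a pairing of the half-edges into edges, and a sign for each edge (a negative edge is a band with a half-twist). Two presentations are equivalent if they agree up to isomorphism of the underlying graphs and flips of vertices (a flip reverses the cyclic order at a vertex and changes the sign of each incident edge once for each of its ends there). Ribbon graphs are the equivalence classes. **States.** In the bubbled blowup $\Gamma^B$ every vertex is replaced by a cycle and every edge by two matching edges (one for each half-edge) with a 2-cycle between them. A state $\alpha$ of $\Gamma^B$ replaces each matching edge by two parallel arcs ($0$-smoothing) or two crossing arcs ($1$-smoothing), which gives $k_\alpha$ circles. A vertex state $\nu\in\{0,1\}^V$ is the state of $\Gamma^B$ that uses the $\nu_v$-smoothing at the three matching edges of each vertex $v$; let $k_\nu$ be its number of circles and $|\nu|=\sum_v\nu_v$. **Maps.** Let $A=\mathbb k[x]/(x^n)$, graded by $\deg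 x^a=m-a$. To an edge of the hypercube of states of $\Gamma^B$ (one smoothing changes from $0$ to $1$) assign the map $A^{\otimes k_\alpha}\to A^{\otimes k_{\alpha'}}$ that is the identity on the unaffected circles and, on the affected ones, is the multiplication of $A$ if two circles merge, $\Delta(x^l)=\sum_{i+j=l+2m,\ 0\le i,j<n}x^i\otimes x^j$ if one circle splits, and $\eta(x^l)=\sqrt n\,x^{l+m}$ if one circle remains one circle. **Complex.** Let $C_n^{i,*}(\Gamma)=\bigoplus_{|\nu|=i}A^{\otimes k_\nu}\{3m|\nu|\}$, where $\{\ell\}$ raises degrees by $\ell$. Number the vertices. For vertex states $\nu\to\nu'$ that differ only at $v$, with $\nu_v=0$ and $\nu'_v=1$, let $\delta_{\nu\nu'}$ be the composite of the three maps along a three-edge path from $\nu$ to $\nu'$ in the hypercube of $\Gamma^B$. Let $\delta$ be the sum of the maps $(-1)^{\#\{u<v\,:\,\nu_u=1\}}\,\delta_{\nu\nu'}$. **Polynomial.** The $n$-color vertex polynomial is $$\langle\!\langle\Gamma\rangle\!\rangle_n=\sum_{\nu\in\{0,1\}^V}(-q^{3m})^{|\nu|}\,(q^m+q^{m-1}+\dots+q^{m-n+1})^{k_\nu}.$$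 **Theorem 1.** 1. $\delta_{\nu\nu'}$ does not depend on the choice among the six three-edge paths; $\delta$ has bidegree $(1,0)$ and $\delta^2=0$. Hence the bigraded $n$-color vertex homology $VCH_n^{i,j}(\Gamma;\mathbb k)=\ker(\delta|_{C_n^{i,j}})/\delta(C_n^{i-1,j})$ is well defined. 2. Up to isomorphism of $\mathbb k$-modules in each bidegree, $VCH_n^{*,*}(\Gamma;\mathbb k)$ depends neither on the numbering of the vertices nor on the presentation: it is an invariant of the ribbon graph $\Gamma$. 3. Its graded Euler characteristic is the $n$-color vertex polynomial, $\chi_q(VCH_n^{*,*}(\Gamma;\mathbb k))=\langle\!\langle\Gamma\rangle\!\rangle_n$. That is, if $\mathbb k$ is an integral domain, $\sum_{i,j}(-1)^iq^j\,\mathrm{rank}_{\mathbb k}VCH_n^{i,j}(\Gamma;\mathbb k)=\langle\!\langle\Gamma\rangle\!\rangle_n$. For arbitrary $\mathbb k$, let $r$ be any function from $\mathbb k$-modules to an abelian group that is additive on short exact sequences whose middle term is a subquotient of a free module of finite rank; then for every $j$, $\sum_i(-1)^i\,r(VCH_n^{i,j}(\Gamma;\mathbb k))$ equals the coefficient of $q^j$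 in $\langle\!\langle\Gamma\rangle\!\rangle_n$ times $r(\mathbb k)$. -/

import Mathlib

open scoped LaurentPolynomial

/-! ## Perfect matching graphs and the hypercube of their states -/

/-- The combinatorial data of a (trivalent) perfect matching ribbon graph that the smoothings of its
matching edges use.  `M` is the set of matching edges.  A matching edge `e` is a band with two
ends `i : Bool`; at the endpoint at end `i` there are two further half-edges, one on each side
`b : Bool` of the band, and `(e, i, b)` denotes this half-edge (sides at the two ends are matched
along the band, i.e. `(e, false, b)` and `(e, true, b)` lie on the same side of it).  Non-matching
edges join these half-edges in pairs by `join`.  `F` is the set of circles without vertices. -/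
structure PerfectMatchingGraph (M F : Type) where
  join : M × Bool × Bool → M × Bool × Bool
  join_join : ∀ p, join (join p) = p
  join_ne : ∀ p, join p ≠ p

namespace PerfectMatchingGraph

variable {M F : Type}

/-- The points through which the circles of a state are recorded. -/
abbrev Point (_D : PerfectMatchingGraph M F) : Type := (M × Bool × Bool) ⊕ F

/-- The arcs of the state `α`: the non-matching edges, and at each matching edge `e` two arcs running
along the band, parallel for the `0`-smoothing and crossing for the `1`-smoothing. -/
inductive Arc (D : PerfectMatchingGraph M F) (α : M → Bool) : D.Point → D.Point → Prop
  | join (p : M × Bool × Bool) : Arc D α (Sum.inl p) (Sum.inl (D.join p))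
  | smoothing (e : M) (b : Bool) :
      Arc D α (Sum.inl (e, false, b)) (Sum.inl (e, true, xor b (α e)))

/-- The (immersed) circles of the state `α`. -/
def Circle (D : PerfectMatchingGraph M F) (α : M → Bool) : Type := Quot (D.Arc α)

/-- The circle of the state `α` through a point. -/
def circ (D : PerfectMatchingGraph M F) (α : M → Bool) (p : D.Point) : D.Circle α := Quot.mk _ p

instance (D : PerfectMatchingGraph M F) [Finite M] [Finite F] (α : M → Bool) :
    Finite (D.Circle α) :=
  Finite.of_surjective (D.circ α) Quot.mk_surjective

/-- The monomial basis of `⨁_α V^{⊗ k_α}`, where `V = 𝕜[x]/(xⁿ)` and `k_α` is the number of circles of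
the state `α`: a pair `⟨α, a⟩` stands for the monomial `⨂_c x^{a c}` of `V^{⊗ k_α}`. -/
abbrev Monomial (D : PerfectMatchingGraph M F) (n : ℕ) : Type :=
  (α : M → Bool) × (D.Circle α → Fin n)

noncomputable instance (D : PerfectMatchingGraph M F) [Finite M] [Finite F] (n : ℕ) :
    Fintype (D.Monomial n) := Fintype.ofFinite _

end PerfectMatchingGraph

section LocalMaps

variable {k : Type*} [CommRing k]

/-- The coefficient of `xˡ` in `m(xⁱ ⊗ xʲ) = x^{i+j}` (and `= 0` if `i + j ≥ n`). -/
def mulCoeff (k : Type*) [CommRing k] {n : ℕ} (i j l : Fin n) : k :=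
  if (l : ℕ) = i + j then 1 else 0

/-- The coefficient of `xⁱ ⊗ xʲ` in `Δ(xˡ) = ∑_{i + j = l + 2m} xⁱ ⊗ xʲ`, with `m = ⌊n/2⌋`. -/
def comulCoeff (k : Type*) [CommRing k] {n : ℕ} (l i j : Fin n) : k :=
  if (i : ℕ) + j = l + 2 * (n / 2) then 1 else 0

/-- The coefficient of `xʲ` in `η(xⁱ) = √n x^{i+m}` (and `= 0` if `i + m ≥ n`), with `m = ⌊n/2⌋`;
the chosen square root of `n` is `s`. -/
def etaCoeff {n : ℕ} (s : k) (i j : Fin n) : k :=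
  if (j : ℕ) = i + n / 2 then s else 0

end LocalMaps

namespace PerfectMatchingGraph

variable {M F : Type} {k : Type*} [CommRing k]

open Classical in
/-- The matrix entry, from the monomial `x = ⟨α, a⟩` to the monomial `y = ⟨α', a'⟩`, of the sum
of all (unsigned) maps of the edges `α → α'` of the hypercube which change the smoothing of the
matching edge `e` from `0` to `1`.  The map is the identity on the circles not running through
`e`.  On the circles through `e` it is `m` if there are two of them in `α`, `Δ` if there is
one in `α` and two in `α'`, and `η` if there is one in both. -/
noncomputable def edgeCoeff (D : PerfectMatchingGraph M F) {n : ℕ} (s : k) (e : M)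
    (x y : D.Monomial n) : k :=
  let c₀ := D.circ x.1 (Sum.inl (e, false, false))
  let c₁ := D.circ x.1 (Sum.inl (e, false, true))
  let d₀ := D.circ y.1 (Sum.inl (e, false, false))
  let d₁ := D.circ y.1 (Sum.inl (e, false, true))
  if x.1 e = false ∧ y.1 e = true ∧ (∀ e', e' ≠ e → y.1 e' = x.1 e') ∧
      ∀ p, D.circ x.1 p ≠ c₀ → D.circ x.1 p ≠ c₁ → y.2 (D.circ y.1 p) = x.2 (D.circ x.1 p) then
    if c₀ ≠ c₁ then mulCoeff k (x.2 c₀) (x.2 c₁) (y.2 d₀)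
    else if d₀ ≠ d₁ then comulCoeff k (x.2 c₀) (y.2 d₀) (y.2 d₁)
    else etaCoeff s (x.2 c₀) (y.2 d₀)
  else 0

/-- The sum of the (unsigned) maps of all edges of the hypercube of states in the direction of the
matching edge `e`.  Vectors of `⨁_α V^{⊗ k_α}` are given by their coordinates in the monomial
basis. -/
noncomputable def edgeMap (D : PerfectMatchingGraph M F) [Finite M] [Finite F] (n : ℕ) (s : k)
    (e : M) : (D.Monomial n → k) →ₗ[k] (D.Monomial n → k) :=
  Matrix.mulVecLin (Matrix.of fun y x => D.edgeCoeff s e x y)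

end PerfectMatchingGraph

/-! ## Trivalent ribbon graphs -/

/-- A trivalent ribbon graph with vertex set `V`, presented by a signed rotation system: `H` is the
set of half-edges, `vert` the vertex of a half-edge, `rot` the cyclic (counterclockwise) order of
the half-edges at each vertex, `opp` the involution whose orbits are the edges, and `twist` tells
which edges are negative (have a half-twist in their band).  `L` is the set of vertexless edges
(circles), `loopTwist` tells which of them are negative. -/
structure TrivalentRibbonGraph (V H L : Type) where
  vert : H → V
  rot : Equiv.Perm H
  opp : H → H
  twist : H → Bool
  loopTwist : L → Bool
  vert_eq_iff : ∀ h h', vert h = vert h' ↔ rot.SameCycle h h'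
  trivalent : ∀ v, Nat.card {h // vert h = v} = 3
  opp_opp : ∀ h, opp (opp h) = h
  opp_ne : ∀ h, opp h ≠ h
  twist_opp : ∀ h, twist (opp h) = twist h

namespace TrivalentRibbonGraph

variable {V H L V' H' L' : Type}

/-- Equivalence of ribbon graphs in terms of signed rotation systems: an isomorphism of the
underlying graphs such that, after flipping the discs of some of the vertices (`flip`), the
cyclic orders agree.  Flipping a vertex reverses its cyclic order and changes the sign of
each incident edge once for each of its ends at that vertex. -/
structure Equivalence (Γ : TrivalentRibbonGraph V H L) (Γ' : TrivalentRibbonGraph V' H' L') where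
  onVert : V ≃ V'
  onHalf : H ≃ H'
  onLoop : L ≃ L'
  flip : V → Bool
  map_vert : ∀ h, Γ'.vert (onHalf h) = onVert (Γ.vert h)
  map_opp : ∀ h, Γ'.opp (onHalf h) = onHalf (Γ.opp h)
  map_rot : ∀ h, flip (Γ.vert h) = false → Γ'.rot (onHalf h) = onHalf (Γ.rot h)
  map_rot_flip : ∀ h, flip (Γ.vert h) = true → Γ'.rot (onHalf (Γ.rot h)) = onHalf h
  map_twist : ∀ h, Γ'.twist (onHalf h) =
    xor (Γ.twist h) (xor (flip (Γ.vert h)) (flip (Γ.vert (Γ.opp h))))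
  map_loopTwist : ∀ l, Γ'.loopTwist (onLoop l) = Γ.loopTwist l

/-- The circles without vertices of the diagrams: the boundary circles of the annulus (two of them) or
Möbius band (one) given by each vertexless edge. -/
abbrev FreeCircle (Γ : TrivalentRibbonGraph V H L) : Type :=
  {c : L × Bool // c.2 = true → Γ.loopTwist c.1 = false}

/-- How the non-matching edges of the bubbled blowup join up, see `bubbledBlowup`. -/
def bubbleJoin (Γ : TrivalentRibbonGraph V H L) : H × Bool × Bool → H × Bool × Bool
  | (h, false, true) => (Γ.rot h, false, false)
  | (h, false, false) => (Γ.rot.symm h, false, true)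
  | (h, true, b) => (Γ.opp h, true, xor (!b) (Γ.twist h))

/-- The bubbled blowup `Γ^B`.  Every vertex is replaced by a cycle and every edge by two matching
edges with a `2`-cycle (bubble) in between, so that there is one matching edge for every
half-edge `h` of `Γ`.  Its end `false` is at the vertex of `h` and its end `true` is at the
bubble.  Looking out from the vertex, its side `true` faces the next half-edge `rot h` and
its side `false` the previous one.  A half-twist of an edge is put into its bubble. -/
def bubbledBlowup (Γ : TrivalentRibbonGraph V H L) : PerfectMatchingGraph H Γ.FreeCircle where
  join := Γ.bubbleJoin
  join_join := by
    rintro ⟨h, _ | _, _ | _⟩ <;> cases ht : Γ.twist h <;>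
      simp [bubbleJoin, Γ.opp_opp, Γ.twist_opp, ht]
  join_ne := by
    rintro ⟨h, _ | _, b⟩
    · cases b <;> simp [bubbleJoin]
    · simp [bubbleJoin, Γ.opp_ne]

/-! ## The hypercube of vertex states -/

/-- The state of the bubbled blowup corresponding to a vertex state `ν`: the vertex `0`-smoothing
(`1`-smoothing) at `v` is the `0`-smoothing (`1`-smoothing) of the three matching edges at `v`. -/
def blowupState (Γ : TrivalentRibbonGraph V H L) (ν : V → Bool) : H → Bool := fun h => ν (Γ.vert h)

/-- The circles of the vertex state `Γ_ν`. -/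
abbrev StateCircle (Γ : TrivalentRibbonGraph V H L) (ν : V → Bool) : Type :=
  Γ.bubbledBlowup.Circle (Γ.blowupState ν)

/-- The monomial basis of `⨁_ν V^{⊗ k_ν}`, the sum over all vertex states `ν`. -/
abbrev VertexMonomial (Γ : TrivalentRibbonGraph V H L) (n : ℕ) : Type :=
  (ν : V → Bool) × (Γ.StateCircle ν → Fin n)

/-- A monomial over a vertex state as a monomial over a state of the bubbled blowup. -/
def toBlowup (Γ : TrivalentRibbonGraph V H L) (n : ℕ) (x : Γ.VertexMonomial n) :
    Γ.bubbledBlowup.Monomial n := ⟨Γ.blowupState x.1, x.2⟩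

/-- The number `|ν|` of vertex `1`-smoothings. -/
noncomputable def weight (ν : V → Bool) : ℕ := Nat.card {v // ν v = true}

/-- The homological degree `|ν|` of a monomial. -/
noncomputable def homDegree (Γ : TrivalentRibbonGraph V H L) {n : ℕ} (x : Γ.VertexMonomial n) : ℤ :=
  weight x.1

/-- The quantum degree of a monomial: `x^a ∈ V` has degree `m - a`, where `m = ⌊n/2⌋`, degrees add
up in tensor products, and the summand of `ν` is shifted by `3m|ν|`. -/
noncomputable def qDegree (Γ : TrivalentRibbonGraph V H L) [Finite H] [Finite L] {n : ℕ}
    (x : Γ.VertexMonomial n) : ℤ :=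
  letI := Fintype.ofFinite (Γ.StateCircle x.1)
  (∑ c, ((n / 2 : ℕ) - (x.2 c : ℕ) : ℤ)) + 3 * (n / 2 : ℕ) * (weight x.1 : ℤ)

section Homology

variable {k : Type*} [CommRing k]

/-- The chain group `C_n^{i,j}(Γ)`, spanned by the monomials of bidegree `(i, j)`. -/
def chain (Γ : TrivalentRibbonGraph V H L) [Finite H] [Finite L] (n : ℕ) (k : Type*) [CommRing k]
    (i j : ℤ) : Submodule k (Γ.VertexMonomial n → k) where
  carrier := {w | ∀ x, ¬ (Γ.homDegree x = i ∧ Γ.qDegree x = j) → w x = 0}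
  add_mem' := by
    intro a b ha hb x hx
    simp [ha x hx, hb x hx]
  zero_mem' := by
    intro x _
    rfl
  smul_mem' := by
    intro c a ha x hx
    simp [ha x hx]

/-- The composite of the maps of three successive edges of the hypercube of states of the bubbled
blowup, changing the smoothings of the matching edges `h₁`, `h₂`, `h₃` in this order, from the
vertex states to the vertex states. -/
noncomputable def threeStep (Γ : TrivalentRibbonGraph V H L) [Finite H] [Finite L] (n : ℕ) (s : k)
    (h₁ h₂ h₃ : H) : (Γ.VertexMonomial n → k) →ₗ[k] (Γ.VertexMonomial n → k) :=
  LinearMap.funLeft k k (Γ.toBlowup n) ∘ₗ Γ.bubbledBlowup.edgeMap n s h₃ ∘ₗ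
    Γ.bubbledBlowup.edgeMap n s h₂ ∘ₗ Γ.bubbledBlowup.edgeMap n s h₁ ∘ₗ
    Function.ExtendByZero.linearMap k (Γ.toBlowup n)

theorem exists_vert_eq (Γ : TrivalentRibbonGraph V H L) (v : V) : ∃ h, Γ.vert h = v := by
  by_contra hv
  have : IsEmpty {h // Γ.vert h = v} := ⟨fun h => hv ⟨h.1, h.2⟩⟩
  have h3 := Γ.trivalent v
  simp at h3

/-- The sum of the maps `δ_{νν'}` of all edges `ν → ν'` of the hypercube of vertex states in the
direction of the vertex `v`: the composite along one of the three-edge paths. -/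
noncomputable def vertexMap (Γ : TrivalentRibbonGraph V H L) [Finite H] [Finite L] (n : ℕ) (s : k)
    (v : V) : (Γ.VertexMonomial n → k) →ₗ[k] (Γ.VertexMonomial n → k) :=
  let h := (Γ.exists_vert_eq v).choose
  Γ.threeStep n s h (Γ.rot h) (Γ.rot (Γ.rot h))

/-- The sign of the edge of the hypercube of vertex states with tail `ν` in the direction of `v`:
`-1` to the number of `1`s to the left of `⋆`, where `o` is the numbering of the vertices. -/
noncomputable def edgeSign {N : ℕ} (o : V ≃ Fin N) (ν : V → Bool) (v : V) : ℤ :=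
  (-1) ^ Nat.card {u // o u < o v ∧ ν u = true}

/-- The differential `δ(w) = ∑_ρ sign(ρ) δ_{νν'}(w)` of the vertex homology. -/
noncomputable def differential (Γ : TrivalentRibbonGraph V H L) [Fintype V] [Finite H] [Finite L]
    (n : ℕ) (s : k) {N : ℕ} (o : V ≃ Fin N) :
    (Γ.VertexMonomial n → k) →ₗ[k] (Γ.VertexMonomial n → k) :=
  ∑ v, Γ.vertexMap n s v ∘ₗ
    LinearMap.pi fun x => (edgeSign o x.1 v : ℤ) • LinearMap.proj (R := k) (φ := fun _ => k) x

/-- The cocycles of bidegree `(i, j)`. -/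
noncomputable def cocycles (Γ : TrivalentRibbonGraph V H L) [Fintype V] [Finite H] [Finite L]
    (n : ℕ) (s : k) {N : ℕ} (o : V ≃ Fin N) (i j : ℤ) : Submodule k (Γ.VertexMonomial n → k) :=
  Γ.chain n k i j ⊓ LinearMap.ker (Γ.differential n s o)

/-- The coboundaries of bidegree `(i, j)`. -/
noncomputable def coboundaries (Γ : TrivalentRibbonGraph V H L) [Fintype V] [Finite H] [Finite L]
    (n : ℕ) (s : k) {N : ℕ} (o : V ≃ Fin N) (i j : ℤ) : Submodule k (Γ.VertexMonomial n → k) :=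
  (Γ.chain n k (i - 1) j).map (Γ.differential n s o)

/-- The bigraded `n`-color vertex homology `VCH_n^{i,j}(Γ; k)`. -/
abbrev VCH (Γ : TrivalentRibbonGraph V H L) [Fintype V] [Finite H] [Finite L]
    (n : ℕ) (s : k) {N : ℕ} (o : V ≃ Fin N) (i j : ℤ) : Type _ :=
  Γ.cocycles n s o i j ⧸ (Γ.coboundaries n s o i j).submoduleOf (Γ.cocycles n s o i j)

end Homology

/-! ## The `n`-color vertex polynomial -/

/-- The loop polynomial `q^m + q^{m-1} + ⋯ + q^{m-n+1}`, with `m = ⌊n/2⌋`. -/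
noncomputable def loopPolynomial (n : ℕ) : ℤ[T;T⁻¹] :=
  ∑ a ∈ Finset.range n, LaurentPolynomial.T ((n / 2 : ℕ) - a : ℤ)

open Classical in
/-- The vertex bracket of the vertex ribbon diagram with some of its vertices already smoothed:
`μ v` is the smoothing done at `v`, or `none` if there is still a dot at `v`.  This is the state
sum; see `vertexBracket_smooth` and `vertexBracket_circles` for the rules characterizing it. -/
noncomputable def vertexBracket (Γ : TrivalentRibbonGraph V H L) [Fintype V] (n : ℕ)
    (μ : V → Option Bool) : ℤ[T;T⁻¹] :=
  ∑ ν : V → Bool, if ∀ v b, μ v = some b → ν v = b then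
    (-LaurentPolynomial.T (3 * (n / 2 : ℕ) : ℤ)) ^ (Nat.card {v // μ v = none ∧ ν v = true}) *
      loopPolynomial n ^ Nat.card (Γ.StateCircle ν)
  else 0

open Classical in
/-- The bracket rule at a dotted vertex. -/
theorem vertexBracket_smooth (Γ : TrivalentRibbonGraph V H L) [Fintype V] (n : ℕ)
    (μ : V → Option Bool) (v : V) (hv : μ v = none) :
    Γ.vertexBracket n μ = Γ.vertexBracket n (Function.update μ v (some false)) -
      LaurentPolynomial.T (3 * (n / 2 : ℕ) : ℤ) *
        Γ.vertexBracket n (Function.update μ v (some true)) := by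
  have key : ∀ (b : Bool) (ν : V → Bool),
      (∀ u c, Function.update μ v (some b) u = some c → ν u = c) ↔
        ((∀ u c, μ u = some c → ν u = c) ∧ ν v = b) := by
    intro b ν
    constructor
    · intro h
      refine ⟨fun u c hu => h u c ?_, h v b (by simp)⟩
      have huv : u ≠ v := by
        rintro rfl
        simp [hv] at hu
      simpa [Function.update_of_ne huv] using hu
    · rintro ⟨h, hb⟩ u c hu
      by_cases huv : u = v
      · subst huv
        simp at hu
        exact hb.trans hu
      · exact h u c (by simpa [Function.update_of_ne huv] using hu)
  unfold vertexBracket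
  rw [Finset.mul_sum, ← Finset.sum_sub_distrib]
  refine Finset.sum_congr rfl fun ν _ => ?_
  simp only [key]
  by_cases hc : ∀ u c, μ u = some c → ν u = c
  · cases hb : ν v
    · have hs : Nat.card {u // μ u = none ∧ ν u = true} =
          Nat.card {u // Function.update μ v (some false) u = none ∧ ν u = true} := by
        refine Nat.card_congr (Equiv.subtypeEquivRight fun u => ?_)
        by_cases huv : u = v
        · subst huv
          simp [hb]
        · simp [Function.update_of_ne huv]
      rw [if_pos hc, if_pos ⟨hc, rfl⟩, if_neg (by simp), hs]
      simp
    · have hs : Nat.card {u // μ u = none ∧ ν u = true} =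
          Nat.card {u // Function.update μ v (some true) u = none ∧ ν u = true} + 1 := by
        rw [Nat.card_eq_fintype_card, Nat.card_eq_fintype_card, Fintype.card_subtype,
          Fintype.card_subtype, ← Finset.card_insert_of_notMem (a := v) (by simp)]
        congr 1
        ext u
        by_cases huv : u = v
        · subst huv
          simp [hb, hv]
        · simp [huv]
      rw [if_pos hc, if_neg (by simp), if_pos ⟨hc, rfl⟩, hs, pow_succ]
      ring
  · rw [if_neg hc, if_neg fun h => hc h.1, if_neg fun h => hc h.1]
    simp

/-- The bracket of a disjoint union of circles is a power of the loop polynomial. -/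
theorem vertexBracket_circles (Γ : TrivalentRibbonGraph V H L) [Fintype V] (n : ℕ)
    (ν : V → Bool) :
    Γ.vertexBracket n (fun v => some (ν v)) =
      loopPolynomial n ^ Nat.card (Γ.StateCircle ν) := by
  classical
  unfold vertexBracket
  rw [Finset.sum_eq_single ν]
  · simp
  · intro ν' _ hne
    rw [if_neg]
    intro h
    exact hne (funext fun v => h v _ rfl)
  · simp

/-- The `n`-color vertex polynomial `⟪Γ⟫_n(q)`. -/
noncomputable def vertexPolynomial (Γ : TrivalentRibbonGraph V H L) [Fintype V] (n : ℕ) :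
    ℤ[T;T⁻¹] := Γ.vertexBracket n fun _ => none

end TrivalentRibbonGraph

/-! ## Euler characteristics over an arbitrary coefficient ring -/

/-- A subquotient of a free module of finite rank. -/
def IsFiniteFreeSubquotient (k M : Type*) [CommRing k] [AddCommGroup M] [Module k M] : Prop :=
  ∃ (r : ℕ) (N : Submodule k (Fin r → k)) (f : N →ₗ[k] M), Function.Surjective f

/-- A rank function on `k`-modules with values in an abelian group, additive on short exact sequences
of subquotients of free modules of finite rank. -/
structure AdditiveRank.{u, w} (k : Type u) [CommRing k] (A : Type w) [AddCommGroup A] where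
  rank : ∀ (M : Type u) [AddCommGroup M] [Module k M], A
  additive : ∀ (M₁ M₂ M₃ : Type u) [AddCommGroup M₁] [AddCommGroup M₂] [AddCommGroup M₃]
    [Module k M₁] [Module k M₂] [Module k M₃] (f : M₁ →ₗ[k] M₂) (g : M₂ →ₗ[k] M₃),
    Function.Injective f → Function.Exact f g → Function.Surjective g →
    IsFiniteFreeSubquotient k M₂ → rank M₂ = rank M₁ + rank M₃

namespace PerfectMatchingGraph

variable {M F : Type} (D : PerfectMatchingGraph M F)

/-- Two states that differ at most at the matching edge `e`. -/
def AgreeOff (e : M) (α β : M → Bool) : Prop := ∀ e', e' ≠ e → β e' = α e'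

theorem AgreeOff.symm {e : M} {α β : M → Bool} (h : AgreeOff e α β) : AgreeOff e β α :=
  fun e' he => (h e' he).symm

/-- The circle `c` runs through the matching edge `e`. -/
def Through (α : M → Bool) (e : M) (c : D.Circle α) : Prop :=
  c = D.circ α (Sum.inl (e, false, false)) ∨ c = D.circ α (Sum.inl (e, false, true))

theorem circ_join (α : M → Bool) (p : M × Bool × Bool) :
    D.circ α (Sum.inl (D.join p)) = D.circ α (Sum.inl p) :=
  (Quot.sound (Arc.join p)).symm

theorem circ_smoothing (α : M → Bool) (e : M) (b : Bool) :
    D.circ α (Sum.inl (e, true, xor b (α e))) = D.circ α (Sum.inl (e, false, b)) :=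
  (Quot.sound (Arc.smoothing e b)).symm

theorem circ_true (α : M → Bool) (e : M) (b : Bool) :
    D.circ α (Sum.inl (e, true, b)) = D.circ α (Sum.inl (e, false, xor b (α e))) := by
  simpa using D.circ_smoothing α e (xor b (α e))

theorem circ_out (α : M → Bool) (c : D.Circle α) : D.circ α c.out = c := Quot.out_eq c

theorem through_circ (α : M → Bool) (e : M) (i b : Bool) :
    D.Through α e (D.circ α (Sum.inl (e, i, b))) := by
  have key : ∀ b, D.Through α e (D.circ α (Sum.inl (e, false, b))) := by
    rintro (_ | _)
    · exact Or.inl rfl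
    · exact Or.inr rfl
  cases i
  · exact key b
  · rw [circ_true]
    exact key _

variable {D}

theorem circ_eq_or_through {e : M} {α β : M → Bool} (h : AgreeOff e α β) {p q : D.Point}
    (hpq : D.circ β p = D.circ β q) :
    D.circ α p = D.circ α q ∨ (D.Through α e (D.circ α p) ∧ D.Through α e (D.circ α q)) := by
  have hg : Relation.EqvGen (D.Arc β) p q := Quot.eqvGen_exact hpq
  clear hpq
  induction hg with
  | rel p q hpq =>
    cases hpq with
    | join p => exact Or.inl (D.circ_join α p).symm
    | smoothing e' b =>
      by_cases he : e' = e
      · subst he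
        exact Or.inr ⟨D.through_circ α e' _ _, D.through_circ α e' _ _⟩
      · rw [h e' he]
        exact Or.inl (D.circ_smoothing α e' b).symm
  | refl p => exact Or.inl rfl
  | symm p q _ ih => exact ih.imp Eq.symm And.symm
  | trans p q r _ _ ih₁ ih₂ =>
    rcases ih₁ with h₁ | h₁
    · rw [h₁]
      exact ih₂
    · rcases ih₂ with h₂ | h₂
      · rw [← h₂]
        exact Or.inr h₁
      · exact Or.inr ⟨h₁.1, h₂.2⟩

theorem through_of_through {e : M} {α β : M → Bool} (h : AgreeOff e α β) {p : D.Point}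
    (hp : D.Through β e (D.circ β p)) : D.Through α e (D.circ α p) := by
  rcases hp with hp | hp <;> rcases circ_eq_or_through h hp with h' | h'
  · rw [h']
    exact D.through_circ ..
  · exact h'.1
  · rw [h']
    exact D.through_circ ..
  · exact h'.1

theorem circ_eq_of_not_through {e : M} {α β : M → Bool} (h : AgreeOff e α β) {p q : D.Point}
    (hp : ¬ D.Through β e (D.circ β p)) (hpq : D.circ β p = D.circ β q) :
    D.circ α p = D.circ α q :=
  (circ_eq_or_through h hpq).resolve_right fun h' => hp (through_of_through h.symm h'.1)

/-- If two circles run through a matching edge, then changing its smoothing merges them. -/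
theorem circ_eq_of_circ_ne [Finite M] {e : M} {α β : M → Bool} (h : AgreeOff e α β)
    (hα : α e = false) (hβ : β e = true)
    (hne : D.circ α (Sum.inl (e, false, false)) ≠ D.circ α (Sum.inl (e, false, true))) :
    D.circ β (Sum.inl (e, false, false)) = D.circ β (Sum.inl (e, false, true)) := by
  classical
  have := Fintype.ofFinite M
  by_contra hne'
  let K : Finset (M × Bool × Bool) := Finset.univ.filter fun p =>
    D.circ α (Sum.inl p) = D.circ α (Sum.inl (e, false, false)) ∧
      D.circ β (Sum.inl p) = D.circ β (Sum.inl (e, false, false))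
  have hK : ∀ p, p ∈ K ↔ D.circ α (Sum.inl p) = D.circ α (Sum.inl (e, false, false)) ∧
      D.circ β (Sum.inl p) = D.circ β (Sum.inl (e, false, false)) := by
    simp [K]
  have heven : ∑ p ∈ K, (1 : ZMod 2) = 0 := by
    refine Finset.sum_involution (fun p _ => D.join p) (fun _ _ => by decide)
      (fun p _ _ => D.join_ne p) (fun p hp => ?_) (fun p _ => D.join_join p)
    rw [hK] at hp ⊢
    rwa [circ_join, circ_join]
  have hmem : ((e, false, false) : M × Bool × Bool) ∈ K := by
    rw [hK]
    exact ⟨rfl, rfl⟩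
  have honly : ∀ i b, ((e, i, b) : M × Bool × Bool) ∈ K → i = false ∧ b = false := by
    intro i b hp
    rw [hK] at hp
    cases i <;> cases b
    · simp
    · exact absurd hp.1.symm hne
    · have h2 := hp.2
      rw [circ_true, hβ] at h2
      exact absurd h2.symm hne'
    · have h1 := hp.1
      rw [circ_true, hα] at h1
      exact absurd h1.symm hne
  have hodd : ∑ p ∈ K.erase (e, false, false), (1 : ZMod 2) = 0 := by
    refine Finset.sum_involution (fun p _ => (p.1, !p.2.1, xor p.2.2 (α p.1)))
      (fun _ _ => by decide) (fun p _ _ hp => ?_) (fun p hp => ?_) (fun p _ => ?_)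
    · have := congrArg (fun p => p.2.1) hp
      simp at this
    · obtain ⟨e', i, b⟩ := p
      rw [Finset.mem_erase] at hp
      have he' : e' ≠ e := by
        rintro rfl
        obtain ⟨rfl, rfl⟩ := honly i b hp.2
        exact hp.1 rfl
      refine Finset.mem_erase.2 ⟨fun h' => he' (congrArg Prod.fst h'), ?_⟩
      have hp2 := hp.2
      rw [hK] at hp2 ⊢
      have key : ∀ γ : M → Bool, γ e' = α e' →
          D.circ γ (Sum.inl (e', !i, xor b (α e'))) = D.circ γ (Sum.inl (e', i, b)) := by
        intro γ hγ
        cases i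
        · rw [← hγ]
          exact D.circ_smoothing γ e' b
        · rw [circ_true, hγ]
          rfl
      exact ⟨(key α rfl).trans hp2.1, (key β (h e' he')).trans hp2.2⟩
    · simp
  rw [← Finset.add_sum_erase _ _ hmem, hodd] at heven
  exact absurd heven (by decide)

open Classical in
@[to_additive]
theorem prod_not_through [Finite M] [Finite F] {R : Type*} [CommMonoid R] {e : M} {α β : M → Bool}
    [Fintype (D.Circle α)] [Fintype (D.Circle β)]
    (h : AgreeOff e α β) (g : D.Circle α → R) (g' : D.Circle β → R)
    (hg : ∀ p, ¬ D.Through α e (D.circ α p) → g (D.circ α p) = g' (D.circ β p)) :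
    ∏ c with ¬ D.Through α e c, g c = ∏ c with ¬ D.Through β e c, g' c := by
  refine Finset.prod_bij' (fun c _ => D.circ β c.out) (fun c _ => D.circ α c.out) ?_ ?_ ?_ ?_ ?_
  · intro c hc
    simp only [Finset.mem_filter, Finset.mem_univ, true_and] at hc ⊢
    intro h'
    have := through_of_through h h'
    rw [circ_out] at this
    exact hc this
  · intro c hc
    simp only [Finset.mem_filter, Finset.mem_univ, true_and] at hc ⊢
    intro h'
    have := through_of_through h.symm h'
    rw [circ_out] at this
    exact hc this
  · intro c hc
    simp only [Finset.mem_filter, Finset.mem_univ, true_and] at hc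
    have h1 : D.circ β (D.circ β c.out).out = D.circ β c.out := D.circ_out _ _
    have h2 : ¬ D.Through β e (D.circ β (D.circ β c.out).out) := by
      rw [h1]
      intro h'
      have := through_of_through h h'
      rw [circ_out] at this
      exact hc this
    rw [circ_eq_of_not_through h h2 h1, circ_out]
  · intro c hc
    simp only [Finset.mem_filter, Finset.mem_univ, true_and] at hc
    have h1 : D.circ α (D.circ α c.out).out = D.circ α c.out := D.circ_out _ _
    have h2 : ¬ D.Through α e (D.circ α (D.circ α c.out).out) := by
      rw [h1]
      intro h'
      have := through_of_through h.symm h'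
      rw [circ_out] at this
      exact hc this
    rw [circ_eq_of_not_through h.symm h2 h1, circ_out]
  · intro c hc
    simp only [Finset.mem_filter, Finset.mem_univ, true_and] at hc
    have := hg c.out (by rwa [circ_out])
    rwa [circ_out] at this

open Classical in
@[to_additive]
theorem prod_circle [Finite M] [Finite F] {R : Type*} [CommMonoid R] (α : M → Bool) (e : M)
    [Fintype (D.Circle α)] (g : D.Circle α → R) :
    ∏ c, g c = (∏ c with ¬ D.Through α e c, g c) *
      if D.circ α (Sum.inl (e, false, false)) ≠ D.circ α (Sum.inl (e, false, true)) then
        g (D.circ α (Sum.inl (e, false, false))) * g (D.circ α (Sum.inl (e, false, true)))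
      else g (D.circ α (Sum.inl (e, false, false))) := by
  rw [← Finset.prod_filter_not_mul_prod_filter (s := Finset.univ) (p := D.Through α e)]
  congr 1
  have hset : Finset.univ.filter (D.Through α e) =
      {D.circ α (Sum.inl (e, false, false)), D.circ α (Sum.inl (e, false, true))} := by
    ext c
    simp [Through]
  rw [hset]
  split_ifs with hne
  · rw [Finset.prod_pair hne]
  · push Not at hne
    simp [← hne]

end PerfectMatchingGraph

/-! ## The cyclic deformation of the edge maps -/

section RootsOfUnity

variable {K : Type*} [Field K] {n : ℕ}

theorem sum_pow_of_modEq {u : K} (hu : u ^ n = 1) (hn : 0 < n) (t : ℕ) :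
    ∑ j : Fin n, (if (j : ℕ) ≡ t [MOD n] then 1 else 0) * u ^ (j : ℕ) = u ^ t := by
  rw [Finset.sum_eq_single (⟨t % n, Nat.mod_lt _ hn⟩ : Fin n)]
  · rw [if_pos (Nat.mod_modEq t n), one_mul]
    exact pow_eq_pow_of_modEq (Nat.mod_modEq t n) hu
  · intro j _ hj
    rw [if_neg, zero_mul]
    intro h
    refine hj (Fin.ext ?_)
    have h' : (j : ℕ) % n = t % n := h
    rwa [Nat.mod_eq_of_lt j.2] at h'
  · simp

theorem sum_pow_of_add_modEq {v : K} (hv : v ^ n = 1) (hn : 0 < n) (i : Fin n) (t : ℕ) :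
    ∑ j : Fin n, (if (i : ℕ) + j ≡ t [MOD n] then 1 else 0) * v ^ (j : ℕ) =
      v ^ t * (v ^ (i : ℕ))⁻¹ := by
  have hv0 : v ≠ 0 := by
    rintro rfl
    simp [hn.ne'] at hv
  have h : ∀ j : Fin n, (i : ℕ) + j ≡ t [MOD n] ↔ (j : ℕ) ≡ t + (n - i) [MOD n] := by
    intro j
    have h1 : (i : ℕ) + (t + (n - i)) ≡ t [MOD n] := by
      rw [show (i : ℕ) + (t + (n - i)) = t + n by have := i.2; omega]
      simp
    constructor
    · intro h
      exact Nat.ModEq.add_left_cancel' (i : ℕ) (h.trans h1.symm)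
    · intro h
      exact (Nat.ModEq.add_left (i : ℕ) h).trans h1
  simp only [h]
  rw [sum_pow_of_modEq hv hn, pow_add]
  congr 1
  refine eq_inv_of_mul_eq_one_left ?_
  rw [← pow_add, Nat.sub_add_cancel i.2.le, hv]

open Classical in
theorem sum_pow_mul_inv_pow {u v : K} (hu : u ^ n = 1) (hv : v ^ n = 1) (hn : 0 < n) :
    ∑ i : Fin n, u ^ (i : ℕ) * (v ^ (i : ℕ))⁻¹ = if u = v then (n : K) else 0 := by
  have hv0 : v ≠ 0 := by
    rintro rfl
    simp [hn.ne'] at hv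
  split_ifs with h
  · subst h
    rw [Finset.sum_congr rfl fun i _ => mul_inv_cancel₀ (pow_ne_zero _ hv0)]
    simp
  · rw [Finset.sum_congr rfl fun (i : Fin n) _ => show u ^ (i : ℕ) * (v ^ (i : ℕ))⁻¹ = (u / v) ^ (i : ℕ) by
      rw [div_pow, div_eq_mul_inv], Fin.sum_univ_eq_sum_range (fun i => (u / v) ^ i)]
    have h1 : u / v ≠ 1 := fun h' => h ((div_eq_one_iff_eq hv0).1 h')
    rw [geom_sum_eq h1, div_pow, hu, hv]
    simp

open Classical in
theorem sum_sum_pow_of_add_modEq {u v : K} (hu : u ^ n = 1) (hv : v ^ n = 1) (hn : 0 < n) (t : ℕ) :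
    ∑ i : Fin n, ∑ j : Fin n, (if (i : ℕ) + j ≡ t [MOD n] then 1 else 0) *
      (u ^ (i : ℕ) * v ^ (j : ℕ)) = if u = v then (n : K) * v ^ t else 0 := by
  have h : ∀ i : Fin n, ∑ j : Fin n, (if (i : ℕ) + j ≡ t [MOD n] then 1 else 0) *
      (u ^ (i : ℕ) * v ^ (j : ℕ)) = v ^ t * (u ^ (i : ℕ) * (v ^ (i : ℕ))⁻¹) := by
    intro i
    rw [show v ^ t * (u ^ (i : ℕ) * (v ^ (i : ℕ))⁻¹) =
      u ^ (i : ℕ) * (v ^ t * (v ^ (i : ℕ))⁻¹) by ring, ← sum_pow_of_add_modEq hv hn i t,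
      Finset.mul_sum]
    exact Finset.sum_congr rfl fun j _ => by ring
  rw [Finset.sum_congr rfl fun i _ => h i, ← Finset.mul_sum, sum_pow_mul_inv_pow hu hv hn]
  split_ifs <;> ring

end RootsOfUnity

namespace PerfectMatchingGraph

variable {M F : Type} (D : PerfectMatchingGraph M F)

open Classical in
/-- The analogue of `edgeCoeff` for the group algebra `k[x]/(xⁿ - 1)`. -/
noncomputable def cyclicEdgeCoeff {k : Type*} [CommRing k] {n : ℕ} (s : k) (e : M)
    (x y : D.Monomial n) : k :=
  let c₀ := D.circ x.1 (Sum.inl (e, false, false))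
  let c₁ := D.circ x.1 (Sum.inl (e, false, true))
  let d₀ := D.circ y.1 (Sum.inl (e, false, false))
  let d₁ := D.circ y.1 (Sum.inl (e, false, true))
  if x.1 e = false ∧ y.1 e = true ∧ (∀ e', e' ≠ e → y.1 e' = x.1 e') ∧
      ∀ p, D.circ x.1 p ≠ c₀ → D.circ x.1 p ≠ c₁ → y.2 (D.circ y.1 p) = x.2 (D.circ x.1 p) then
    if c₀ ≠ c₁ then if (y.2 d₀ : ℕ) ≡ x.2 c₀ + x.2 c₁ [MOD n] then 1 else 0
    else if d₀ ≠ d₁ then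
      if (y.2 d₀ : ℕ) + y.2 d₁ ≡ x.2 c₀ + 2 * (n / 2) [MOD n] then 1 else 0
    else s * if (y.2 d₀ : ℕ) ≡ x.2 c₀ + n / 2 [MOD n] then 1 else 0
  else 0

open Classical in
/-- The monomial over the state `β` with prescribed exponents on the circles through `e` and the
exponents of `x` on all other circles. -/
noncomputable def extend {n : ℕ} (e : M) (x : D.Monomial n) (β : M → Bool) (i j : Fin n) :
    D.Monomial n :=
  ⟨β, fun c => if c = D.circ β (Sum.inl (e, false, false)) then i
    else if c = D.circ β (Sum.inl (e, false, true)) then j else x.2 (D.circ x.1 c.out)⟩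

variable {D}

theorem not_through_iff {α : M → Bool} {e : M} {c : D.Circle α} : ¬ D.Through α e c ↔
    c ≠ D.circ α (Sum.inl (e, false, false)) ∧ c ≠ D.circ α (Sum.inl (e, false, true)) := by
  simp [Through]

theorem extend_circ {n : ℕ} {e : M} {x : D.Monomial n} {β : M → Bool} (h : AgreeOff e x.1 β)
    (i j : Fin n) (p : D.Point) (hp : ¬ D.Through x.1 e (D.circ x.1 p)) :
    (D.extend e x β i j).2 (D.circ β p) = x.2 (D.circ x.1 p) := by
  have h1 : ¬ D.Through β e (D.circ β p) := fun h' => hp (through_of_through h h')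
  have h2 := not_through_iff.1 h1
  simp only [extend]
  rw [if_neg h2.1, if_neg h2.2]
  rw [circ_eq_of_not_through h h1 (D.circ_out β _).symm]

theorem eq_extend {n : ℕ} {e : M} {x y : D.Monomial n} {β : M → Bool} (h : AgreeOff e x.1 β)
    (hβ : y.1 = β)
    (hy : ∀ p, ¬ D.Through x.1 e (D.circ x.1 p) → y.2 (D.circ y.1 p) = x.2 (D.circ x.1 p)) :
    y = D.extend e x β (y.2 (D.circ y.1 (Sum.inl (e, false, false))))
      (y.2 (D.circ y.1 (Sum.inl (e, false, true)))) := by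
  subst hβ
  obtain ⟨β, b⟩ := y
  simp only [extend]
  congr 1
  funext c
  split_ifs with h0 h1
  · rw [h0]
  · rw [h1]
  · have hc : ¬ D.Through β e (D.circ β c.out) := by
      rw [circ_out]
      exact not_through_iff.2 ⟨h0, h1⟩
    have := hy c.out fun h' => hc (through_of_through h.symm h')
    rwa [circ_out] at this

theorem extend_left {n : ℕ} (e : M) (x : D.Monomial n) (β : M → Bool) (i j : Fin n) :
    (D.extend e x β i j).2 (D.circ β (Sum.inl (e, false, false))) = i := by
  simp [extend]

theorem extend_injective {n : ℕ} {e : M} {x : D.Monomial n} {β : M → Bool} {i j i' j' : Fin n}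
    (h : D.extend e x β i j = D.extend e x β i' j') : i = i' ∧
      (D.circ β (Sum.inl (e, false, false)) ≠ D.circ β (Sum.inl (e, false, true)) → j = j') := by
  simp only [extend, Sigma.mk.injEq, heq_eq_eq, true_and] at h
  refine ⟨by simpa using congrFun h (D.circ β (Sum.inl (e, false, false))), fun hd => ?_⟩
  simpa [hd.symm] using congrFun h (D.circ β (Sum.inl (e, false, true)))

theorem extend_right {n : ℕ} (e : M) (x : D.Monomial n) (β : M → Bool) (i j : Fin n)
    (h : D.circ β (Sum.inl (e, false, false)) ≠ D.circ β (Sum.inl (e, false, true))) :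
    (D.extend e x β i j).2 (D.circ β (Sum.inl (e, false, true))) = j := by
  simp [extend, h.symm]

variable (D)

/-- A coloring of the points that is constant on the circles of the state `α`. -/
def Consistent {K : Type*} (f : D.Point → K) (α : M → Bool) : Prop :=
  ∀ p q, D.circ α p = D.circ α q → f p = f q

variable {D}

theorem Consistent.out {K : Type*} {f : D.Point → K} {α : M → Bool} (hf : D.Consistent f α)
    (p : D.Point) : f (D.circ α p).out = f p :=
  hf _ _ (D.circ_out α _)

theorem consistent_iff {K : Type*} {f : D.Point → K} {α : M → Bool} :
    D.Consistent f α ↔ ∀ p q, D.Arc α p q → f p = f q := by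
  constructor
  · exact fun h p q hpq => h p q (Quot.sound hpq)
  · intro h p q hpq
    exact congrArg (Quot.lift f h) hpq

theorem Consistent.of_agreeOff {K : Type*} {f : D.Point → K} {e : M} {α β : M → Bool}
    (h : AgreeOff e α β) (hf : D.Consistent f α)
    (he : f (Sum.inl (e, false, false)) = f (Sum.inl (e, false, true))) : D.Consistent f β := by
  have hc : ∀ i b, f (Sum.inl (e, i, b)) = f (Sum.inl (e, false, false)) := by
    intro i b
    have h0 : ∀ b, f (Sum.inl (e, false, b)) = f (Sum.inl (e, false, false)) := by
      rintro (_ | _)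
      · rfl
      · exact he.symm
    cases i
    · exact h0 b
    · exact (hf _ _ (D.circ_true α e b)).trans (h0 _)
  rw [consistent_iff]
  rintro p q (p | ⟨e', b⟩)
  · exact hf _ _ (D.circ_join α p).symm
  · by_cases he' : e' = e
    · rw [he']
      exact (hc _ _).trans (hc _ _).symm
    · rw [h e' he']
      exact hf _ _ (D.circ_smoothing α e' b).symm

open Classical in
/-- The dual vector, over all states, of the idempotent belonging to a coloring of the points by
`n`-th roots of unity. -/
noncomputable def colorVector {K : Type*} [Field K] {n : ℕ} [Finite M] [Finite F] (s : K)
    (f : D.Point → K) (y : D.Monomial n) : K :=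
  letI := Fintype.ofFinite (D.Circle y.1)
  if D.Consistent f y.1 then ∏ c, (s * f c.out ^ (n / 2))⁻¹ * f c.out ^ (y.2 c : ℕ) else 0

open Classical in
theorem sum_cyclicEdgeCoeff_mul_colorVector {K : Type*} [Field K] {n : ℕ} [Finite M] [Finite F]
    (hn : 0 < n) {s : K} (hs : s ^ 2 = n) (hs0 : s ≠ 0) (f : D.Point → K) (hf : ∀ p, f p ^ n = 1)
    (g : (M → Bool) → K) (e : M) (x : D.Monomial n) :
    ∑ y, D.cyclicEdgeCoeff s e x y * (g y.1 * colorVector s f y) =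
      (if x.1 e = false ∧ f (Sum.inl (e, false, false)) = f (Sum.inl (e, false, true)) then
        g (Function.update x.1 e true) * (s * f (Sum.inl (e, false, false)) ^ (n / 2)) else 0) *
          colorVector s f x := by
  by_cases hx : x.1 e = false
  swap
  · rw [if_neg (fun h => hx h.1), zero_mul]
    refine Finset.sum_eq_zero fun y _ => ?_
    rw [cyclicEdgeCoeff, if_neg (fun h => hx h.1), zero_mul]
  set β := Function.update x.1 e true with hβ
  have hag : AgreeOff e x.1 β := fun e' he' => by simp [hβ, he']
  have hβe : β e = true := by simp [hβ]
  have hf0 : ∀ p, f p ≠ 0 := by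
    intro p h
    have := hf p
    rw [h] at this
    simp [hn.ne'] at this
  set c₀ := D.circ x.1 (Sum.inl (e, false, false))
  set c₁ := D.circ x.1 (Sum.inl (e, false, true))
  set d₀ := D.circ β (Sum.inl (e, false, false)) with hd₀
  set d₁ := D.circ β (Sum.inl (e, false, true)) with hd₁
  set u := f (Sum.inl (e, false, false)) with hu
  set v := f (Sum.inl (e, false, true)) with hv
  have htop : c₀ ≠ c₁ → d₀ = d₁ := circ_eq_of_circ_ne hag hx hβe
  -- the support of the row of `x`
  have hsupp : ∀ y, D.cyclicEdgeCoeff s e x y ≠ 0 → y.1 = β ∧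
      ∀ p, ¬ D.Through x.1 e (D.circ x.1 p) → y.2 (D.circ y.1 p) = x.2 (D.circ x.1 p) := by
    intro y hy
    rw [cyclicEdgeCoeff] at hy
    have hcond := (ite_ne_right_iff.1 hy).1
    refine ⟨?_, fun p hp => ?_⟩
    · funext e'
      by_cases he' : e' = e
      · subst he'
        rw [hβe, hcond.2.1]
      · rw [hag e' he', hcond.2.2.1 e' he']
    · have := not_through_iff.1 hp
      exact hcond.2.2.2 p this.1 this.2
  have hcond : ∀ i j, x.1 e = false ∧ (D.extend e x β i j).1 e = true ∧
      (∀ e', e' ≠ e → (D.extend e x β i j).1 e' = x.1 e') ∧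
      ∀ p, D.circ x.1 p ≠ c₀ → D.circ x.1 p ≠ c₁ →
        (D.extend e x β i j).2 (D.circ (D.extend e x β i j).1 p) = x.2 (D.circ x.1 p) := by
    intro i j
    refine ⟨hx, hβe, hag, fun p h0 h1 => ?_⟩
    exact extend_circ hag i j p (not_through_iff.2 ⟨h0, h1⟩)
  have hext : ∀ y, D.cyclicEdgeCoeff s e x y ≠ 0 →
      y = D.extend e x β (y.2 (D.circ y.1 (Sum.inl (e, false, false))))
        (y.2 (D.circ y.1 (Sum.inl (e, false, true)))) :=
    fun y hy => eq_extend hag (hsupp y hy).1 (hsupp y hy).2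
  let _ := Fintype.ofFinite (D.Circle x.1)
  let _ := Fintype.ofFinite (D.Circle β)
  set R := ∏ c : D.Circle β with ¬ D.Through β e c,
    (s * f c.out ^ (n / 2))⁻¹ * f c.out ^ (x.2 (D.circ x.1 c.out) : ℕ)
  have hφx : D.Consistent f x.1 → D.Consistent f β → colorVector s f x = R *
      if c₀ ≠ c₁ then ((s * u ^ (n / 2))⁻¹ * u ^ (x.2 c₀ : ℕ)) *
        ((s * v ^ (n / 2))⁻¹ * v ^ (x.2 c₁ : ℕ))
      else (s * u ^ (n / 2))⁻¹ * u ^ (x.2 c₀ : ℕ) := by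
    intro h hβ'
    rw [colorVector, if_pos h, prod_circle x.1 e, h.out, h.out]
    congr 1
    refine prod_not_through hag _ _ fun p hp => ?_
    have hp' : ¬ D.Through β e (D.circ β p) := fun h' => hp (through_of_through hag h')
    rw [h.out, hβ'.out, circ_eq_of_not_through hag hp' (D.circ_out β _).symm]
  have hφy : ∀ i j, D.Consistent f β →
      colorVector s f (D.extend e x β i j) = R *
        if d₀ ≠ d₁ then ((s * u ^ (n / 2))⁻¹ * u ^ (i : ℕ)) *
          ((s * v ^ (n / 2))⁻¹ * v ^ (j : ℕ))
        else (s * u ^ (n / 2))⁻¹ * u ^ (i : ℕ) := by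
    intro i j hβ'
    rw [colorVector, if_pos (show D.Consistent f (D.extend e x β i j).1 from hβ')]
    change (∏ c : D.Circle β, (s * f c.out ^ (n / 2))⁻¹ *
      f c.out ^ ((D.extend e x β i j).2 c : ℕ)) = _
    rw [prod_circle β e, hβ'.out, hβ'.out, extend_left]
    congr 1
    · refine Finset.prod_congr rfl fun c hc => ?_
      simp only [Finset.mem_filter, Finset.mem_univ, true_and] at hc
      have hp : ¬ D.Through x.1 e (D.circ x.1 c.out) := by
        intro h'
        have := through_of_through hag.symm h'
        rw [circ_out] at this
        exact hc this
      have := extend_circ hag i j c.out hp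
      rw [circ_out] at this
      rw [this]
    · split_ifs with hd
      · rw [extend_right _ _ _ _ _ hd]
      · rfl
  by_cases hcβ : D.Consistent f β
  swap
  · have hrhs : (if x.1 e = false ∧ u = v then g β * (s * u ^ (n / 2)) else 0) *
        colorVector s f x = 0 := by
      split_ifs with h
      · rw [colorVector, if_neg, mul_zero]
        exact fun h' => hcβ (h'.of_agreeOff hag h.2)
      · rw [zero_mul]
    rw [hrhs]
    refine Finset.sum_eq_zero fun y _ => ?_
    by_cases hy : D.cyclicEdgeCoeff s e x y = 0
    · rw [hy, zero_mul]
    · rw [colorVector, if_neg, mul_zero, mul_zero]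
      rwa [(hsupp y hy).1]
  have hcα : u = v → D.Consistent f x.1 := hcβ.of_agreeOff hag.symm
  have hsu : s * u ^ (n / 2) ≠ 0 := mul_ne_zero hs0 (pow_ne_zero _ (hf0 _))
  by_cases hd : d₀ = d₁
  · have huv : u = v := hcβ _ _ hd
    have hsum : ∑ y, D.cyclicEdgeCoeff s e x y * (g y.1 * colorVector s f y) =
        ∑ i : Fin n, D.cyclicEdgeCoeff s e x (D.extend e x β i i) *
          (g β * colorVector s f (D.extend e x β i i)) := by
      refine (Fintype.sum_of_injective (fun i => D.extend e x β i i) ?_ _ _ ?_ fun i => rfl).symm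
      · exact fun i i' hi => (extend_injective hi).1
      · intro y hy
        by_contra h0
        have hy0 := left_ne_zero_of_mul h0
        refine hy ⟨y.2 (D.circ y.1 (Sum.inl (e, false, false))), ?_⟩
        have hy1 := hext y hy0
        have hd' : D.circ y.1 (Sum.inl (e, false, false)) =
            D.circ y.1 (Sum.inl (e, false, true)) := by
          rw [(hsupp y hy0).1]
          exact hd
        rw [← hd'] at hy1
        exact hy1.symm
    rw [hsum, if_pos ⟨hx, huv⟩, hφx (hcα huv) hcβ]
    have hval : ∀ i, D.cyclicEdgeCoeff s e x (D.extend e x β i i) =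
        if c₀ ≠ c₁ then if (i : ℕ) ≡ x.2 c₀ + x.2 c₁ [MOD n] then 1 else 0
        else s * if (i : ℕ) ≡ x.2 c₀ + n / 2 [MOD n] then 1 else 0 := by
      intro i
      rw [cyclicEdgeCoeff]
      rw [if_pos (hcond i i)]
      have h0 : (D.extend e x β i i).2 (D.circ (D.extend e x β i i).1 (Sum.inl (e, false, false)))
        = i := extend_left ..
      rw [h0]
      congr 1
      exact if_neg (not_not.2 hd)
    simp only [hval, hφy _ _ hcβ, if_neg (not_not.2 hd)]
    by_cases hc : c₀ = c₁
    · simp only [if_neg (not_not.2 hc)]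
      have := sum_pow_of_modEq (hf (Sum.inl (e, false, false))) hn ((x.2 c₀ : ℕ) + n / 2)
      rw [← hu] at this
      calc _ = (g β * s * R * (s * u ^ (n / 2))⁻¹) * ∑ j : Fin n,
            (if (j : ℕ) ≡ (x.2 c₀ : ℕ) + n / 2 [MOD n] then 1 else 0) * u ^ (j : ℕ) := by
            rw [Finset.mul_sum]
            exact Finset.sum_congr rfl fun j _ => by ring
        _ = _ := by
            rw [this, pow_add]
            ring
    · simp only [if_pos hc]
      have := sum_pow_of_modEq (hf (Sum.inl (e, false, false))) hn ((x.2 c₀ : ℕ) + x.2 c₁)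
      rw [← hu] at this
      calc _ = (g β * R * (s * u ^ (n / 2))⁻¹) * ∑ j : Fin n,
            (if (j : ℕ) ≡ (x.2 c₀ : ℕ) + x.2 c₁ [MOD n] then 1 else 0) * u ^ (j : ℕ) := by
            rw [Finset.mul_sum]
            exact Finset.sum_congr rfl fun j _ => by ring
        _ = _ := by
            rw [this, pow_add, ← huv]
            field_simp
  · have hc : c₀ = c₁ := by
      by_contra hc
      exact hd (htop hc)
    have hsum : ∑ y, D.cyclicEdgeCoeff s e x y * (g y.1 * colorVector s f y) =
        ∑ ij : Fin n × Fin n, D.cyclicEdgeCoeff s e x (D.extend e x β ij.1 ij.2) *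
          (g β * colorVector s f (D.extend e x β ij.1 ij.2)) := by
      refine (Fintype.sum_of_injective (fun ij : Fin n × Fin n => D.extend e x β ij.1 ij.2)
        ?_ _ _ ?_ fun i => rfl).symm
      · rintro ⟨i, j⟩ ⟨i', j'⟩ hi
        exact Prod.ext (extend_injective hi).1 ((extend_injective hi).2 hd)
      · intro y hy
        by_contra h0
        exact hy ⟨(_, _), (hext y (left_ne_zero_of_mul h0)).symm⟩
    have hval : ∀ i j, D.cyclicEdgeCoeff s e x (D.extend e x β i j) =
        if (i : ℕ) + j ≡ x.2 c₀ + 2 * (n / 2) [MOD n] then 1 else 0 := by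
      intro i j
      rw [cyclicEdgeCoeff]
      rw [if_pos (hcond i j), if_neg (not_not.2 hc)]
      refine (if_pos hd).trans ?_
      have h0 : (D.extend e x β i j).2 (D.circ (D.extend e x β i j).1 (Sum.inl (e, false, false)))
        = i := extend_left ..
      have h1 : (D.extend e x β i j).2 (D.circ (D.extend e x β i j).1 (Sum.inl (e, false, true)))
        = j := extend_right _ _ _ _ _ hd
      rw [h0, h1]
    rw [hsum, Fintype.sum_prod_type]
    simp only [hval, hφy _ _ hcβ, if_pos hd]
    have := sum_sum_pow_of_add_modEq (hf (Sum.inl (e, false, false)))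
      (hf (Sum.inl (e, false, true))) hn ((x.2 c₀ : ℕ) + 2 * (n / 2))
    rw [← hu, ← hv] at this
    calc _ = (g β * R * (s * u ^ (n / 2))⁻¹ * (s * v ^ (n / 2))⁻¹) *
          ∑ i : Fin n, ∑ j : Fin n,
            (if (i : ℕ) + j ≡ (x.2 c₀ : ℕ) + 2 * (n / 2) [MOD n] then 1 else 0) *
              (u ^ (i : ℕ) * v ^ (j : ℕ)) := by
          rw [Finset.mul_sum]
          refine Finset.sum_congr rfl fun i _ => ?_
          rw [Finset.mul_sum]
          exact Finset.sum_congr rfl fun j _ => by ring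
      _ = _ := by
          rw [this]
          by_cases huv : u = v
          · rw [if_pos huv, if_pos ⟨hx, huv⟩, hφx (hcα huv) hcβ, if_neg (not_not.2 hc), ← huv,
              ← hs, pow_add, pow_mul']
            field_simp
          · rw [if_neg huv, if_neg (fun h => huv h.2)]
            ring

end PerfectMatchingGraph

theorem Polynomial.aeval_eq_zero_of_sq_eq {k : Type*} [CommRing k] {n : ℕ} (hn : 0 < n)
    {p : Polynomial ℤ} (hp : ∀ t : ℂ, t ^ 2 = n → Polynomial.aeval t p = 0) {s : k}
    (hs : s ^ 2 = n) : Polynomial.aeval s p = 0 := by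
  open Polynomial in
  have hmonic : (X ^ 2 - C (n : ℤ)).Monic := monic_X_pow_sub_C _ two_ne_zero
  have hp' := modByMonic_add_div p (X ^ 2 - C (n : ℤ))
  have hr : (p %ₘ (X ^ 2 - C (n : ℤ))).degree ≤ 1 := by
    have h1 := degree_modByMonic_lt p hmonic
    rw [degree_X_pow_sub_C two_pos] at h1
    exact Order.le_of_lt_succ h1
  have hr' := eq_X_add_C_of_degree_le_one hr
  set r := p %ₘ (X ^ 2 - C (n : ℤ))
  have hev : ∀ t : ℂ, t ^ 2 = n → (r.coeff 1 : ℂ) * t + (r.coeff 0 : ℂ) = 0 := by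
    intro t ht
    have h1 := hp t ht
    rw [← hp', hr'] at h1
    simpa [ht] using h1
  obtain ⟨t, ht⟩ := IsAlgClosed.exists_pow_nat_eq (n : ℂ) two_pos
  have h1 := hev t ht
  have h2 := hev (-t) (by rw [neg_sq, ht])
  have ht0 : t ≠ 0 := by
    rintro rfl
    rw [zero_pow two_ne_zero] at ht
    exact hn.ne (Nat.cast_injective (R := ℂ) (by simpa using ht))
  have h3 : (r.coeff 0 : ℂ) = 0 := by linear_combination (h1 + h2) / 2
  have h4 : (r.coeff 1 : ℂ) = 0 := by
    rw [h3, add_zero] at h1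
    exact (mul_eq_zero.1 h1).resolve_right ht0
  have h5 : r = 0 := by
    rw [hr', Int.cast_eq_zero.1 h3, Int.cast_eq_zero.1 h4]
    simp
  rw [← hp', h5]
  simp [hs]

namespace PerfectMatchingGraph

theorem map_edgeCoeff {M F : Type} {D : PerfectMatchingGraph M F} {k k' : Type*} [CommRing k] [CommRing k'] (φ : k →+* k') {n : ℕ} (s : k)
    (e : M) (x y : D.Monomial n) : φ (D.edgeCoeff s e x y) = D.edgeCoeff (φ s) e x y := by
  simp only [edgeCoeff, mulCoeff, comulCoeff, etaCoeff]
  split_ifs <;> simp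

variable {M F : Type} {D : PerfectMatchingGraph M F} [Finite M] [Finite F]

open Classical in
/-- The color vectors, cut down to single states, separate vectors. -/
theorem eq_zero_of_sum_mul_colorVector {n : ℕ} (hn : 0 < n) {s : ℂ} (hs0 : s ≠ 0)
    {L : D.Monomial n → ℂ} (h : ∀ f : D.Point → ℂ, (∀ p, f p ^ n = 1) → ∀ g : (M → Bool) → ℂ,
      ∑ y, L y * (g y.1 * colorVector s f y) = 0) : L = 0 := by
  funext ⟨β, b₀⟩
  let _ := Fintype.ofFinite (D.Circle β)
  set ζ := Complex.exp (2 * Real.pi * Complex.I / n)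
  have hζ : IsPrimitiveRoot ζ n := Complex.isPrimitiveRoot_exp n hn.ne'
  have hζ0 : ζ ≠ 0 := Complex.exp_ne_zero _
  have hpow : ∀ a : ℕ, (ζ ^ a) ^ n = 1 := fun a => by
    rw [← pow_mul, mul_comm, pow_mul, hζ.pow_eq_one, one_pow]
  have hvec : ∀ C : D.Circle β → Fin n,
      ∑ b : D.Circle β → Fin n, L ⟨β, b⟩ *
        ∏ c, ((s * (ζ ^ (C c : ℕ)) ^ (n / 2))⁻¹ * (ζ ^ (C c : ℕ)) ^ (b c : ℕ)) = 0 := by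
    intro C
    rw [← h (fun p => ζ ^ (C (D.circ β p) : ℕ)) (fun p => hpow _) fun γ => if γ = β then 1 else 0]
    refine Fintype.sum_of_injective (fun b => (⟨β, b⟩ : D.Monomial n)) ?_ _ _ ?_ fun b => ?_
    · intro b b' hb
      simpa using hb
    · rintro ⟨γ, b⟩ hγ
      rw [if_neg, zero_mul, mul_zero]
      rintro rfl
      exact hγ ⟨b, rfl⟩
    · rw [if_pos rfl, one_mul, colorVector, if_pos]
      · congr 1
        refine Finset.prod_congr rfl fun c _ => ?_
        rw [circ_out]
      · intro p q hpq
        change ζ ^ (C (D.circ β p) : ℕ) = ζ ^ (C (D.circ β q) : ℕ)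
        rw [show D.circ β p = D.circ β q from hpq]
  have hsum : ∑ b : D.Circle β → Fin n, L ⟨β, b⟩ * ∑ C : D.Circle β → Fin n,
      ∏ c, ((ζ ^ (b c : ℕ)) ^ (C c : ℕ) * ((ζ ^ (b₀ c : ℕ)) ^ (C c : ℕ))⁻¹) = 0 := by
    simp only [Finset.mul_sum]
    rw [Finset.sum_comm]
    refine Finset.sum_eq_zero fun C _ => ?_
    rw [← mul_zero (∏ c, ((s * (ζ ^ (C c : ℕ)) ^ (n / 2)) * ((ζ ^ (C c : ℕ)) ^ (b₀ c : ℕ))⁻¹)),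
      ← hvec C, Finset.mul_sum]
    refine Finset.sum_congr rfl fun b _ => ?_
    rw [mul_left_comm, ← Finset.prod_mul_distrib]
    congr 1
    refine Finset.prod_congr rfl fun c _ => ?_
    have h1 : s * (ζ ^ (C c : ℕ)) ^ (n / 2) ≠ 0 :=
      mul_ne_zero hs0 (pow_ne_zero _ (pow_ne_zero _ hζ0))
    rw [pow_right_comm ζ (b c), pow_right_comm ζ (b₀ c)]
    field_simp
  rw [Finset.sum_eq_single b₀] at hsum
  · refine (mul_eq_zero.1 hsum).resolve_right ?_
    have h1 : ∀ (a i : ℕ), (ζ ^ a) ^ i * ((ζ ^ a) ^ i)⁻¹ = 1 := fun a i =>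
      mul_inv_cancel₀ (pow_ne_zero _ (pow_ne_zero _ hζ0))
    simp only [h1, Finset.prod_const_one, Finset.sum_const, nsmul_eq_mul, mul_one]
    exact Nat.cast_ne_zero.2 (Finset.card_ne_zero_of_mem (Finset.mem_univ b₀))
  · intro b _ hb
    obtain ⟨c, hc⟩ := Function.ne_iff.1 hb
    have := Fintype.prod_sum fun (c : D.Circle β) (i : Fin n) =>
      (ζ ^ (b c : ℕ)) ^ (i : ℕ) * ((ζ ^ (b₀ c : ℕ)) ^ (i : ℕ))⁻¹
    rw [← this, Finset.prod_eq_zero (Finset.mem_univ c), mul_zero]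
    rw [sum_pow_mul_inv_pow (hpow _) (hpow _) hn, if_neg]
    intro h'
    exact hc (Fin.ext (hζ.pow_inj (b c).2 (b₀ c).2 h'))
  · simp

theorem cyclicEdgeCoeff_comm {n : ℕ} (hn : 0 < n) {s : ℂ} (hs : s ^ 2 = n) (e e' : M)
    (x z : D.Monomial n) :
    ∑ y, D.cyclicEdgeCoeff s e x y * D.cyclicEdgeCoeff s e' y z =
      ∑ y, D.cyclicEdgeCoeff s e' x y * D.cyclicEdgeCoeff s e y z := by
  classical
  have hs0 : s ≠ 0 := by
    rintro rfl
    rw [zero_pow two_ne_zero] at hs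
    exact hn.ne (Nat.cast_injective (R := ℂ) (by simpa using hs))
  rcases eq_or_ne e e' with rfl | hee
  · rfl
  have hcomp : ∀ (e e' : M) (f : D.Point → ℂ), (∀ p, f p ^ n = 1) → ∀ g : (M → Bool) → ℂ,
      ∑ z, (∑ y, D.cyclicEdgeCoeff s e x y * D.cyclicEdgeCoeff s e' y z) *
        (g z.1 * colorVector s f z) = ∑ y, D.cyclicEdgeCoeff s e x y *
          ((if y.1 e' = false ∧ f (Sum.inl (e', false, false)) = f (Sum.inl (e', false, true)) then
        g (Function.update y.1 e' true) * (s * f (Sum.inl (e', false, false)) ^ (n / 2)) else 0) *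
          colorVector s f y) := by
    intro e e' f hf g
    simp only [Finset.sum_mul]
    rw [Finset.sum_comm]
    refine Finset.sum_congr rfl fun y _ => ?_
    rw [← sum_cyclicEdgeCoeff_mul_colorVector hn hs hs0 f hf g e' y, Finset.mul_sum]
    exact Finset.sum_congr rfl fun z _ => by ring
  have key := eq_zero_of_sum_mul_colorVector (D := D) hn hs0 (L := fun z =>
    (∑ y, D.cyclicEdgeCoeff s e x y * D.cyclicEdgeCoeff s e' y z) -
      ∑ y, D.cyclicEdgeCoeff s e' x y * D.cyclicEdgeCoeff s e y z) fun f hf g => by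
    simp only [sub_mul, Finset.sum_sub_distrib]
    rw [hcomp e e' f hf g, hcomp e' e f hf g,
      sum_cyclicEdgeCoeff_mul_colorVector hn hs hs0 f hf (fun γ => if γ e' = false ∧
        f (Sum.inl (e', false, false)) = f (Sum.inl (e', false, true)) then
        g (Function.update γ e' true) * (s * f (Sum.inl (e', false, false)) ^ (n / 2)) else 0),
      sum_cyclicEdgeCoeff_mul_colorVector hn hs hs0 f hf (fun γ => if γ e = false ∧
        f (Sum.inl (e, false, false)) = f (Sum.inl (e, false, true)) then
        g (Function.update γ e true) * (s * f (Sum.inl (e, false, false)) ^ (n / 2)) else 0),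
      ← sub_mul]
    simp only [Function.update_of_ne hee, Function.update_of_ne hee.symm,
      Function.update_comm hee]
    split_ifs <;> ring
  exact sub_eq_zero.1 (congrFun key z)

variable (D) in
/-- The degree of a monomial, without the shift. -/
noncomputable def degree {n : ℕ} (x : D.Monomial n) : ℤ :=
  letI := Fintype.ofFinite (D.Circle x.1)
  ∑ c, ((n / 2 : ℕ) - (x.2 c : ℕ) : ℤ)

open Classical in
theorem degree_sub_degree {n : ℕ} {e : M} {x y : D.Monomial n} (h : AgreeOff e x.1 y.1)
    (hy : ∀ p, ¬ D.Through x.1 e (D.circ x.1 p) → y.2 (D.circ y.1 p) = x.2 (D.circ x.1 p)) :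
    D.degree y - D.degree x =
      (if D.circ y.1 (Sum.inl (e, false, false)) ≠ D.circ y.1 (Sum.inl (e, false, true)) then
        ((n / 2 : ℕ) - (y.2 (D.circ y.1 (Sum.inl (e, false, false))) : ℕ) : ℤ) +
          ((n / 2 : ℕ) - (y.2 (D.circ y.1 (Sum.inl (e, false, true))) : ℕ) : ℤ)
      else ((n / 2 : ℕ) - (y.2 (D.circ y.1 (Sum.inl (e, false, false))) : ℕ) : ℤ)) -
      (if D.circ x.1 (Sum.inl (e, false, false)) ≠ D.circ x.1 (Sum.inl (e, false, true)) then
        ((n / 2 : ℕ) - (x.2 (D.circ x.1 (Sum.inl (e, false, false))) : ℕ) : ℤ) +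
          ((n / 2 : ℕ) - (x.2 (D.circ x.1 (Sum.inl (e, false, true))) : ℕ) : ℤ)
      else ((n / 2 : ℕ) - (x.2 (D.circ x.1 (Sum.inl (e, false, false))) : ℕ) : ℤ)) := by
  let _ := Fintype.ofFinite (D.Circle x.1)
  let _ := Fintype.ofFinite (D.Circle y.1)
  rw [degree, degree, sum_circle x.1 e, sum_circle y.1 e,
    sum_not_through h (fun c => ((n / 2 : ℕ) - (x.2 c : ℕ) : ℤ))
      (fun c => ((n / 2 : ℕ) - (y.2 c : ℕ) : ℤ)) fun p hp => by rw [hy p hp]]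
  ring

open Classical in
theorem edgeCoeff_eq_cyclicEdgeCoeff {k : Type*} [CommRing k] {n : ℕ} (s : k) (e : M)
    (x y : D.Monomial n) :
    (D.cyclicEdgeCoeff s e x y ≠ 0 → D.degree x - (n / 2 : ℕ) ≤ D.degree y) ∧
      D.edgeCoeff s e x y =
        if D.degree y = D.degree x - (n / 2 : ℕ) then D.cyclicEdgeCoeff s e x y else 0 := by
  by_cases hcond : x.1 e = false ∧ y.1 e = true ∧ (∀ e', e' ≠ e → y.1 e' = x.1 e') ∧
      ∀ p, D.circ x.1 p ≠ D.circ x.1 (Sum.inl (e, false, false)) →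
        D.circ x.1 p ≠ D.circ x.1 (Sum.inl (e, false, true)) →
          y.2 (D.circ y.1 p) = x.2 (D.circ x.1 p)
  swap
  · rw [edgeCoeff, cyclicEdgeCoeff, if_neg hcond, if_neg hcond]
    simp
  have hag : AgreeOff e x.1 y.1 := hcond.2.2.1
  have hdeg := degree_sub_degree hag fun p hp =>
    hcond.2.2.2 p (not_through_iff.1 hp).1 (not_through_iff.1 hp).2
  have htop := circ_eq_of_circ_ne (D := D) hag hcond.1 hcond.2.1
  simp only [edgeCoeff, cyclicEdgeCoeff]
  rw [if_pos hcond, if_pos hcond]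
  have hy0 := (y.2 (D.circ y.1 (Sum.inl (e, false, false)))).2
  have hy1 := (y.2 (D.circ y.1 (Sum.inl (e, false, true)))).2
  by_cases hc : D.circ x.1 (Sum.inl (e, false, false)) ≠ D.circ x.1 (Sum.inl (e, false, true))
  · rw [if_pos hc, if_pos hc]
    rw [if_pos hc, if_neg (not_not.2 (htop hc))] at hdeg
    rw [mulCoeff]
    constructor
    · intro h
      have h' := (ite_ne_right_iff.1 h).1.le_of_lt_add (by omega)
      omega
    · split_ifs with h1 h2 h3 h2 h3
      · rfl
      · exact absurd (by rw [h1]) h3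
      · omega
      · omega
      · rfl
      · rfl
  · rw [if_neg hc, if_neg hc]
    rw [if_neg hc] at hdeg
    by_cases hd : D.circ y.1 (Sum.inl (e, false, false)) ≠ D.circ y.1 (Sum.inl (e, false, true))
    · rw [if_pos hd, if_pos hd]
      rw [if_pos hd] at hdeg
      rw [comulCoeff]
      constructor
      · intro h
        have h' := (ite_ne_right_iff.1 h).1.le_of_lt_add (by omega)
        omega
      · split_ifs with h1 h2 h3 h2 h3
        · rfl
        · exact absurd (by rw [h1]) h3
        · omega
        · omega
        · rfl
        · rfl
    · rw [if_neg hd, if_neg hd]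
      rw [if_neg hd] at hdeg
      rw [etaCoeff]
      constructor
      · intro h
        have h' := (ite_ne_right_iff.1 (right_ne_zero_of_mul h)).1.le_of_lt_add (by omega)
        omega
      · split_ifs with h1 h2 h3 h2 h3
        · rw [mul_one]
        · exact absurd (by rw [h1]) h3
        · omega
        · omega
        · rw [mul_zero]
        · rfl

theorem degree_of_edgeCoeff_ne_zero {k : Type*} [CommRing k] {n : ℕ} {s : k} {e : M}
    {x y : D.Monomial n} (h : D.edgeCoeff s e x y ≠ 0) :
    D.degree y = D.degree x - (n / 2 : ℕ) := by
  rw [(edgeCoeff_eq_cyclicEdgeCoeff s e x y).2] at h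
  exact (ite_ne_right_iff.1 h).1

theorem sum_edgeCoeff_mul_edgeCoeff {k : Type*} [CommRing k] {n : ℕ} (s : k) (e e' : M)
    (x z : D.Monomial n) :
    ∑ y, D.edgeCoeff s e x y * D.edgeCoeff s e' y z =
      if D.degree z = D.degree x - (n / 2 : ℕ) - (n / 2 : ℕ) then
        ∑ y, D.cyclicEdgeCoeff s e x y * D.cyclicEdgeCoeff s e' y z else 0 := by
  split_ifs with h
  · refine Finset.sum_congr rfl fun y _ => ?_
    obtain ⟨h1, h1'⟩ := edgeCoeff_eq_cyclicEdgeCoeff s e x y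
    obtain ⟨h2, h2'⟩ := edgeCoeff_eq_cyclicEdgeCoeff s e' y z
    rw [h1', h2']
    by_cases h3 : D.cyclicEdgeCoeff s e x y = 0
    · simp [h3]
    by_cases h4 : D.cyclicEdgeCoeff s e' y z = 0
    · simp [h4]
    have h5 := h1 h3
    have h6 := h2 h4
    rw [if_pos (by omega), if_pos (by omega)]
  · refine Finset.sum_eq_zero fun y _ => ?_
    by_contra h0
    have h1 := degree_of_edgeCoeff_ne_zero (left_ne_zero_of_mul h0)
    have h2 := degree_of_edgeCoeff_ne_zero (right_ne_zero_of_mul h0)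
    omega

theorem edgeMap_comm {k : Type*} [CommRing k] {n : ℕ} (hn : 0 < n) {s : k} (hs : s ^ 2 = n)
    (e e' : M) : D.edgeMap n s e ∘ₗ D.edgeMap n s e' = D.edgeMap n s e' ∘ₗ D.edgeMap n s e := by
  have key : ∀ x z : D.Monomial n, ∑ y, D.edgeCoeff s e x y * D.edgeCoeff s e' y z =
      ∑ y, D.edgeCoeff s e' x y * D.edgeCoeff s e y z := by
    intro x z
    have := Polynomial.aeval_eq_zero_of_sq_eq hn (p :=
      ∑ y, D.edgeCoeff Polynomial.X e x y * D.edgeCoeff Polynomial.X e' y z -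
        ∑ y, D.edgeCoeff Polynomial.X e' x y * D.edgeCoeff Polynomial.X e y z) (fun t ht => ?_) hs
    · have hm := fun (e : M) (x y : D.Monomial n) => map_edgeCoeff
        (Polynomial.aeval (R := ℤ) s).toRingHom Polynomial.X e x y
      simp only [AlgHom.toRingHom_eq_coe, RingHom.coe_coe, Polynomial.aeval_X] at hm
      simp only [map_sub, map_sum, map_mul, hm] at this
      exact sub_eq_zero.1 this
    · have hm := fun (e : M) (x y : D.Monomial n) => map_edgeCoeff
        (Polynomial.aeval (R := ℤ) t).toRingHom Polynomial.X e x y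
      simp only [AlgHom.toRingHom_eq_coe, RingHom.coe_coe, Polynomial.aeval_X] at hm
      simp only [map_sub, map_sum, map_mul, hm]
      rw [sum_edgeCoeff_mul_edgeCoeff, sum_edgeCoeff_mul_edgeCoeff, cyclicEdgeCoeff_comm hn ht,
        sub_self]
  rw [edgeMap, edgeMap, ← Matrix.mulVecLin_mul, ← Matrix.mulVecLin_mul]
  congr 1
  ext z x
  simp only [Matrix.mul_apply, Matrix.of_apply]
  calc _ = ∑ y, D.edgeCoeff s e' x y * D.edgeCoeff s e y z :=
        Finset.sum_congr rfl fun y _ => mul_comm _ _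
    _ = _ := by
        rw [← key]
        exact Finset.sum_congr rfl fun y _ => mul_comm _ _

end PerfectMatchingGraph

namespace PerfectMatchingGraph

variable {M F : Type} {D : PerfectMatchingGraph M F} [Finite M] [Finite F]

open Classical in
theorem exists_of_edgeMap_ne_zero {k : Type*} [CommRing k] {n : ℕ} {s : k} {e : M}
    {w : D.Monomial n → k} {y : D.Monomial n} (h : D.edgeMap n s e w y ≠ 0) :
    ∃ x, w x ≠ 0 ∧ x.1 e = false ∧ y.1 e = true ∧ AgreeOff e x.1 y.1 ∧
      D.degree y = D.degree x - (n / 2 : ℕ) := by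
  obtain ⟨x, -, hx⟩ := Finset.exists_ne_zero_of_sum_ne_zero
    (show ∑ x, D.edgeCoeff s e x y * w x ≠ 0 from h)
  have h1 := left_ne_zero_of_mul hx
  have h2 := degree_of_edgeCoeff_ne_zero h1
  rw [edgeCoeff] at h1
  have h3 := (ite_ne_right_iff.1 h1).1
  exact ⟨x, right_ne_zero_of_mul hx, h3.1, h3.2.1, h3.2.2.1, h2⟩

end PerfectMatchingGraph

namespace TrivalentRibbonGraph

open PerfectMatchingGraph

variable {V H L : Type} (Γ : TrivalentRibbonGraph V H L)

theorem vert_rot (h : H) : Γ.vert (Γ.rot h) = Γ.vert h :=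
  (Γ.vert_eq_iff _ _).2 (Equiv.Perm.sameCycle_apply_left.2 (Equiv.Perm.SameCycle.refl _ _))

theorem rot_ne [Finite H] (h : H) : Γ.rot h ≠ h ∧ Γ.rot (Γ.rot h) ≠ h ∧
    ∀ h', Γ.vert h' = Γ.vert h → h' = h ∨ h' = Γ.rot h ∨ h' = Γ.rot (Γ.rot h) := by
  classical
  have := Fintype.ofFinite H
  set S : Finset H := Finset.univ.filter fun h' => Γ.vert h' = Γ.vert h
  have hS : ∀ h', h' ∈ S ↔ Γ.vert h' = Γ.vert h := by simp [S]
  have hcard : S.card = 3 := by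
    rw [← Γ.trivalent (Γ.vert h), Nat.card_eq_fintype_card, Fintype.card_subtype]
  have hcyc : Γ.rot.IsCycleOn S := by
    refine ⟨⟨fun a ha => ?_, Γ.rot.injective.injOn, fun a ha => ?_⟩, fun a ha b hb => ?_⟩
    · rw [Finset.mem_coe, hS] at ha ⊢
      rw [vert_rot, ha]
    · refine ⟨Γ.rot.symm a, ?_, Γ.rot.apply_symm_apply a⟩
      rw [Finset.mem_coe, hS] at ha ⊢
      rw [← vert_rot, Equiv.apply_symm_apply, ha]
    · rw [Finset.mem_coe, hS] at ha hb
      exact (Γ.vert_eq_iff a b).1 (ha.trans hb.symm)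
  have hh : h ∈ S := (hS h).2 rfl
  have h1 : Γ.rot h ≠ h := by
    intro h'
    have := (hcyc.pow_apply_eq hh (n := 1)).1 (by simpa using h')
    rw [hcard] at this
    omega
  have h2 : Γ.rot (Γ.rot h) ≠ h := by
    intro h'
    have := (hcyc.pow_apply_eq hh (n := 2)).1 (by simpa [pow_two] using h')
    rw [hcard] at this
    omega
  refine ⟨h1, h2, fun h' hh' => ?_⟩
  have hsub : ({h, Γ.rot h, Γ.rot (Γ.rot h)} : Finset H) ⊆ S := by
    intro a ha
    simp only [Finset.mem_insert, Finset.mem_singleton] at ha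
    rw [hS]
    rcases ha with rfl | rfl | rfl <;> simp [vert_rot]
  have heq := Finset.eq_of_subset_of_card_le hsub (by
    rw [hcard, Finset.card_eq_three.2 ⟨h, Γ.rot h, Γ.rot (Γ.rot h), h1.symm, h2.symm,
      fun h' => h1 (Γ.rot.injective h'.symm), rfl⟩])
  have := (hS h').2 hh'
  rw [← heq] at this
  simpa using this

theorem blowupState_injective : Function.Injective Γ.blowupState := by
  intro ν ν' h
  funext v
  obtain ⟨a, rfl⟩ := Γ.exists_vert_eq v
  exact congrFun h a

theorem toBlowup_injective (n : ℕ) : Function.Injective (Γ.toBlowup n) := by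
  rintro ⟨ν, a⟩ ⟨ν', a'⟩ h
  have h1 : ν = ν' := Γ.blowupState_injective (congrArg Sigma.fst h)
  subst h1
  simpa [toBlowup] using h

theorem mem_range_toBlowup {n : ℕ} {y : Γ.bubbledBlowup.Monomial n} {ν : V → Bool}
    (h : y.1 = Γ.blowupState ν) : ∃ x, Γ.toBlowup n x = y ∧ x.1 = ν := by
  obtain ⟨α, a⟩ := y
  subst h
  exact ⟨⟨ν, a⟩, rfl, rfl⟩

/-- Multiplication of each monomial by a number depending on its state. -/
def scale (k : Type*) [CommRing k] (n : ℕ) (σ : (V → Bool) → ℤ) :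
    (Γ.VertexMonomial n → k) →ₗ[k] (Γ.VertexMonomial n → k) :=
  LinearMap.pi fun x => σ x.1 • LinearMap.proj (R := k) (φ := fun _ => k) x

theorem scale_apply {k : Type*} [CommRing k] {n : ℕ} (σ : (V → Bool) → ℤ) (w : Γ.VertexMonomial n → k) (x : Γ.VertexMonomial n) :
    Γ.scale k n σ w x = σ x.1 • w x := rfl

variable [Finite H] [Finite L] {k : Type*} [CommRing k] {n : ℕ}

/-- The composite of three edge maps of the bubbled blowup. -/
noncomputable def blowupThreeStep (n : ℕ) (s : k) (h₁ h₂ h₃ : H) :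
    Module.End k (Γ.bubbledBlowup.Monomial n → k) :=
  Γ.bubbledBlowup.edgeMap n s h₃ ∘ₗ Γ.bubbledBlowup.edgeMap n s h₂ ∘ₗ
    Γ.bubbledBlowup.edgeMap n s h₁

theorem threeStep_apply (s : k) (h₁ h₂ h₃ : H) (w : Γ.VertexMonomial n → k)
    (y : Γ.VertexMonomial n) : Γ.threeStep n s h₁ h₂ h₃ w y =
      Γ.blowupThreeStep n s h₁ h₂ h₃ (Function.extend (Γ.toBlowup n) w 0) (Γ.toBlowup n y) :=
  rfl

theorem blowupThreeStep_swap_left (hn : 0 < n) {s : k} (hs : s ^ 2 = n) (h₁ h₂ h₃ : H) :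
    Γ.blowupThreeStep n s h₁ h₂ h₃ = Γ.blowupThreeStep n s h₂ h₁ h₃ := by
  rw [blowupThreeStep, blowupThreeStep, edgeMap_comm hn hs h₂ h₁]

theorem blowupThreeStep_swap_right (hn : 0 < n) {s : k} (hs : s ^ 2 = n) (h₁ h₂ h₃ : H) :
    Γ.blowupThreeStep n s h₁ h₂ h₃ = Γ.blowupThreeStep n s h₁ h₃ h₂ := by
  rw [blowupThreeStep, blowupThreeStep, ← LinearMap.comp_assoc, edgeMap_comm hn hs h₃ h₂,
    LinearMap.comp_assoc]

theorem blowupThreeStep_eq (hn : 0 < n) {s : k} (hs : s ^ 2 = n) {a b c h₁ h₂ h₃ : H}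
    (ha : h₁ = a ∨ h₁ = b ∨ h₁ = c) (hb : h₂ = a ∨ h₂ = b ∨ h₂ = c)
    (hc : h₃ = a ∨ h₃ = b ∨ h₃ = c) (h12 : h₁ ≠ h₂) (h13 : h₁ ≠ h₃) (h23 : h₂ ≠ h₃) :
    Γ.blowupThreeStep n s h₁ h₂ h₃ = Γ.blowupThreeStep n s a b c := by
  have hl := Γ.blowupThreeStep_swap_left hn hs
  have hr := Γ.blowupThreeStep_swap_right hn hs
  rcases ha with rfl | rfl | rfl <;> rcases hb with rfl | rfl | rfl <;>
    rcases hc with rfl | rfl | rfl <;> first | contradiction | skip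
  · rfl
  · exact hr _ _ _
  · exact hl _ _ _
  · exact (hr _ _ _).trans (hl _ _ _)
  · exact (hl _ _ _).trans (hr _ _ _)
  · exact (hl _ _ _).trans ((hr _ _ _).trans (hl _ _ _))

theorem threeStep_eq_vertexMap (hn : 0 < n) {s : k} (hs : s ^ 2 = n) {v : V} {h₁ h₂ h₃ : H}
    (hv₁ : Γ.vert h₁ = v) (hv₂ : Γ.vert h₂ = v) (hv₃ : Γ.vert h₃ = v)
    (h12 : h₁ ≠ h₂) (h13 : h₁ ≠ h₃) (h23 : h₂ ≠ h₃) :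
    Γ.threeStep n s h₁ h₂ h₃ = Γ.vertexMap n s v := by
  have hv := (Γ.exists_vert_eq v).choose_spec
  have hrot := (Γ.rot_ne (Γ.exists_vert_eq v).choose).2.2
  rw [hv] at hrot
  have := Γ.blowupThreeStep_eq hn hs (hrot _ hv₁) (hrot _ hv₂) (hrot _ hv₃) h12 h13 h23
  refine LinearMap.ext fun w => funext fun y => ?_
  change _ = Γ.threeStep n s _ _ _ w y
  rw [threeStep_apply, threeStep_apply, this]

open Classical in
theorem exists_of_blowupThreeStep_ne_zero {s : k} {v : V} {w : Γ.VertexMonomial n → k}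
    {y : Γ.bubbledBlowup.Monomial n}
    (hy : Γ.blowupThreeStep n s (Γ.exists_vert_eq v).choose (Γ.rot (Γ.exists_vert_eq v).choose)
      (Γ.rot (Γ.rot (Γ.exists_vert_eq v).choose)) (Function.extend (Γ.toBlowup n) w 0) y ≠ 0) :
    ∃ x y', w x ≠ 0 ∧ Γ.toBlowup n y' = y ∧ x.1 v = false ∧ y'.1 = Function.update x.1 v true ∧
      Γ.bubbledBlowup.degree y = Γ.bubbledBlowup.degree (Γ.toBlowup n x) - 3 * (n / 2 : ℕ) := by
  have hv := (Γ.exists_vert_eq v).choose_spec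
  obtain ⟨-, -, hrot⟩ := Γ.rot_ne (Γ.exists_vert_eq v).choose
  rw [hv] at hrot
  set h := (Γ.exists_vert_eq v).choose
  obtain ⟨x₂, hx₂, hf₃, ht₃, hag₃, hd₃⟩ := exists_of_edgeMap_ne_zero hy
  obtain ⟨x₁, hx₁, hf₂, ht₂, hag₂, hd₂⟩ := exists_of_edgeMap_ne_zero hx₂
  obtain ⟨x₀, hx₀, hf₁, ht₁, hag₁, hd₁⟩ := exists_of_edgeMap_ne_zero hx₁
  obtain ⟨x, rfl⟩ : ∃ x, Γ.toBlowup n x = x₀ := by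
    by_contra hne
    exact hx₀ (Function.extend_apply' _ _ _ hne)
  rw [(Γ.toBlowup_injective n).extend_apply] at hx₀
  have hst : y.1 = Γ.blowupState (Function.update x.1 v true) := by
    have h2t : ∀ a, x₁.1 a = true → x₂.1 a = true := fun a ha => by
      by_cases h' : a = Γ.rot h
      · rw [h', ht₂]
      · rw [hag₂ a h', ha]
    have h3t : ∀ a, x₂.1 a = true → y.1 a = true := fun a ha => by
      by_cases h' : a = Γ.rot (Γ.rot h)
      · rw [h', ht₃]
      · rw [hag₃ a h', ha]
    funext a
    by_cases ha : Γ.vert a = v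
    · rw [blowupState, ha, Function.update_self]
      rcases hrot a ha with rfl | rfl | rfl
      · exact h3t _ (h2t _ ht₁)
      · exact h3t _ ht₂
      · exact ht₃
    · have hne : ∀ b, Γ.vert b = v → a ≠ b := by
        rintro b hb rfl
        exact ha hb
      rw [blowupState, Function.update_of_ne ha, hag₃ a (hne _ (by rw [vert_rot, vert_rot, hv])),
        hag₂ a (hne _ (by rw [vert_rot, hv])), hag₁ a (hne _ hv)]
      rfl
  obtain ⟨y', hy', hy'1⟩ := Γ.mem_range_toBlowup hst
  refine ⟨x, y', hx₀, hy', ?_, hy'1, by omega⟩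
  rw [← hv]
  exact hf₁

theorem extend_vertexMap (s : k) (v : V) (w : Γ.VertexMonomial n → k) :
    Function.extend (Γ.toBlowup n) (Γ.vertexMap n s v w) 0 =
      Γ.blowupThreeStep n s (Γ.exists_vert_eq v).choose (Γ.rot (Γ.exists_vert_eq v).choose)
        (Γ.rot (Γ.rot (Γ.exists_vert_eq v).choose)) (Function.extend (Γ.toBlowup n) w 0) := by
  classical
  funext y
  by_cases hy : ∃ x, Γ.toBlowup n x = y
  · obtain ⟨x, rfl⟩ := hy
    rw [(Γ.toBlowup_injective n).extend_apply]
    rfl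
  · rw [Function.extend_apply' _ _ _ hy]
    by_contra h
    obtain ⟨-, y', -, hy', -⟩ := Γ.exists_of_blowupThreeStep_ne_zero (Ne.symm h)
    exact hy ⟨y', hy'⟩

open Classical in
theorem exists_of_vertexMap_ne_zero {s : k} {v : V} {w : Γ.VertexMonomial n → k}
    {y : Γ.VertexMonomial n} (hy : Γ.vertexMap n s v w y ≠ 0) :
    ∃ x, w x ≠ 0 ∧ x.1 v = false ∧ y.1 = Function.update x.1 v true ∧
      Γ.bubbledBlowup.degree (Γ.toBlowup n y) =
        Γ.bubbledBlowup.degree (Γ.toBlowup n x) - 3 * (n / 2 : ℕ) := by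
  obtain ⟨x, y', hx, hy', h1, h2, h3⟩ := Γ.exists_of_blowupThreeStep_ne_zero hy
  rw [Γ.toBlowup_injective n hy'] at h2
  exact ⟨x, hx, h1, h2, h3⟩

theorem blowupThreeStep_comm (hn : 0 < n) {s : k} (hs : s ^ 2 = n) (a b c a' b' c' : H) :
    Commute (Γ.blowupThreeStep n s a b c) (Γ.blowupThreeStep n s a' b' c') := by
  have h : ∀ e e', Commute (S := Module.End k (Γ.bubbledBlowup.Monomial n → k))
      (Γ.bubbledBlowup.edgeMap n s e) (Γ.bubbledBlowup.edgeMap n s e') :=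
    fun e e' => edgeMap_comm hn hs e e'
  have h3 : ∀ e, Commute (Γ.blowupThreeStep n s a b c)
      (Γ.bubbledBlowup.edgeMap n s e : Module.End k (Γ.bubbledBlowup.Monomial n → k)) :=
    fun e => (h c e).mul_left ((h b e).mul_left (h a e))
  exact (h3 c').mul_right ((h3 b').mul_right (h3 a'))

theorem vertexMap_comm (hn : 0 < n) {s : k} (hs : s ^ 2 = n) (u v : V)
    (w : Γ.VertexMonomial n → k) :
    Γ.vertexMap n s u (Γ.vertexMap n s v w) = Γ.vertexMap n s v (Γ.vertexMap n s u w) := by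
  refine Function.extend_injective (Γ.toBlowup_injective n) 0 ?_
  simp only [extend_vertexMap]
  rw [← Module.End.mul_apply, (Γ.blowupThreeStep_comm hn hs _ _ _ _ _ _).eq, Module.End.mul_apply]

theorem vertexMap_vertexMap_self (s : k) (v : V) (w : Γ.VertexMonomial n → k) :
    Γ.vertexMap n s v (Γ.vertexMap n s v w) = 0 := by
  classical
  funext y
  by_contra h
  obtain ⟨x, hx, h1, -⟩ := Γ.exists_of_vertexMap_ne_zero h
  obtain ⟨z, -, -, h2, -⟩ := Γ.exists_of_vertexMap_ne_zero hx
  rw [h2] at h1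
  simp at h1

open Classical in
/-- A function of the state that changes by a factor along the edges of the hypercube in one
direction commutes with the maps in this direction, up to this factor. -/
theorem scale_vertexMap [Finite V] (s : k) {σ τ : (V → Bool) → ℤ} {v : V}
    (h : ∀ ν, ν v = false → σ (Function.update ν v true) = τ ν)
    (w : Γ.VertexMonomial n → k) :
    Γ.scale k n σ (Γ.vertexMap n s v w) = Γ.vertexMap n s v (Γ.scale k n τ w) := by
  have key : Γ.scale k n σ ∘ₗ Γ.vertexMap n s v = Γ.vertexMap n s v ∘ₗ Γ.scale k n τ := by
    refine LinearMap.pi_ext fun x a => funext fun y => ?_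
    have h1 : Γ.scale k n τ (Pi.single x a) = τ x.1 • Pi.single x a := by
      funext z
      rw [scale_apply, Pi.smul_apply]
      by_cases hz : z = x
      · rw [hz]
      · simp [hz]
    rw [LinearMap.comp_apply, LinearMap.comp_apply, h1, map_zsmul, scale_apply, Pi.smul_apply]
    by_cases hy : Γ.vertexMap n s v (Pi.single x a) y = 0
    · rw [hy, smul_zero, smul_zero]
    · obtain ⟨z, hz, h2, h3, -⟩ := Γ.exists_of_vertexMap_ne_zero hy
      have hzx : z = x := by
        by_contra hne
        simp [hne] at hz
      subst hzx
      rw [h3, h z.1 h2]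
  exact LinearMap.congr_fun key w

open Classical in
theorem weight_update [Finite V] {ν : V → Bool} {v : V} (h : ν v = false) :
    weight (Function.update ν v true) = weight ν + 1 := by
  have := Fintype.ofFinite V
  rw [weight, weight, Nat.card_eq_fintype_card, Nat.card_eq_fintype_card, Fintype.card_subtype,
    Fintype.card_subtype, ← Finset.card_insert_of_notMem (a := v) (by simp [h])]
  congr 1
  ext u
  by_cases huv : u = v
  · simp [huv]
  · simp [huv]

theorem qDegree_eq (x : Γ.VertexMonomial n) : Γ.qDegree x =
    Γ.bubbledBlowup.degree (Γ.toBlowup n x) + 3 * (n / 2 : ℕ) * (weight x.1 : ℤ) := rfl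

variable [Fintype V] {N : ℕ} (o : V ≃ Fin N)

theorem differential_apply (s : k) (w : Γ.VertexMonomial n → k) :
    Γ.differential n s o w =
      ∑ v, Γ.vertexMap n s v (Γ.scale k n (fun ν => edgeSign o ν v) w) := by
  rw [differential, LinearMap.sum_apply]
  rfl

theorem differential_mem_chain (s : k) {i j : ℤ} {w : Γ.VertexMonomial n → k}
    (hw : w ∈ Γ.chain n k i j) : Γ.differential n s o w ∈ Γ.chain n k (i + 1) j := by
  classical
  rw [differential_apply]
  refine Submodule.sum_mem _ fun v _ => ?_
  intro y hy
  by_contra h0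
  obtain ⟨x, hx, h1, h2, h3⟩ := Γ.exists_of_vertexMap_ne_zero h0
  have hwx : w x ≠ 0 := fun h' => hx (by rw [scale_apply, h', smul_zero])
  have hx' : Γ.homDegree x = i ∧ Γ.qDegree x = j := by
    by_contra h'
    exact hwx (hw x h')
  refine hy ?_
  have hwt := weight_update h1
  rw [qDegree_eq] at hx' ⊢
  rw [homDegree] at hx' ⊢
  rw [h2, h3, hwt]
  simp only [Nat.cast_add, Nat.cast_one]
  constructor <;> linarith [hx'.1, hx'.2]

open Classical in
theorem edgeSign_update {ν : V → Bool} {u v : V} (h : ν u = false) :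
    edgeSign o (Function.update ν u true) v =
      (if o u < o v then -1 else 1) * edgeSign o ν v := by
  rw [edgeSign, edgeSign]
  split_ifs with huv
  · rw [← pow_succ']
    congr 1
    rw [Nat.card_eq_fintype_card, Nat.card_eq_fintype_card, Fintype.card_subtype,
      Fintype.card_subtype, ← Finset.card_insert_of_notMem (a := u) (by simp [h])]
    congr 1
    ext t
    by_cases htu : t = u
    · simp [htu, huv]
    · simp [htu]
  · rw [one_mul]
    congr 1
    refine Nat.card_congr (Equiv.subtypeEquivRight fun t => ?_)
    by_cases htu : t = u
    · simp [htu, huv]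
    · simp [htu]

theorem differential_differential (hn : 0 < n) {s : k} (hs : s ^ 2 = n)
    (w : Γ.VertexMonomial n → k) : Γ.differential n s o (Γ.differential n s o w) = 0 := by
  classical
  have hterm : ∀ u v, Γ.vertexMap n s v (Γ.scale k n (fun ν => edgeSign o ν v)
      (Γ.vertexMap n s u (Γ.scale k n (fun ν => edgeSign o ν u) w))) =
      (if o u < o v then -1 else 1 : ℤ) • Γ.vertexMap n s v (Γ.vertexMap n s u
        (Γ.scale k n (fun ν => edgeSign o ν v * edgeSign o ν u) w)) := by
    intro u v
    rw [Γ.scale_vertexMap s (τ := fun ν => (if o u < o v then -1 else 1) * edgeSign o ν v)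
      fun ν hν => edgeSign_update o hν, ← map_zsmul, ← map_zsmul]
    congr 2
    funext x
    simp only [scale_apply, Pi.smul_apply, smul_smul, mul_assoc]
  rw [differential_apply, differential_apply]
  simp only [map_sum, hterm]
  rw [← Finset.sum_product']
  refine Finset.sum_involution (fun p _ => p.swap) (fun p _ => ?_) (fun p _ hp h => hp ?_)
    (fun p _ => by simp) fun p _ => p.swap_swap
  · obtain ⟨v, u⟩ := p
    simp only [Prod.fst_swap, Prod.snd_swap]
    rw [Γ.vertexMap_comm hn hs u v]
    simp only [mul_comm (edgeSign o _ u)]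
    rw [← add_smul]
    rcases lt_trichotomy (o u) (o v) with h | h | h
    · simp [h, h.not_gt]
    · rw [o.injective h, vertexMap_vertexMap_self, smul_zero]
    · simp [h, h.not_gt]
  · obtain ⟨v, u⟩ := p
    obtain rfl : u = v := congrArg Prod.fst h
    rw [vertexMap_vertexMap_self, smul_zero]

end TrivalentRibbonGraph

namespace PerfectMatchingGraph

variable {M F M' F' : Type}

/-- An isomorphism of perfect matching graphs which may interchange the two sides of some
matching edges. -/
structure Iso (D : PerfectMatchingGraph M F) (D' : PerfectMatchingGraph M' F') where
  onEdge : M ≃ M'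
  onFree : F ≃ F'
  flip : M → Bool
  map_join : ∀ p q, D.join p = q → D'.join (onEdge p.1, p.2.1, xor p.2.2 (flip p.1)) =
    (onEdge q.1, q.2.1, xor q.2.2 (flip q.1))

namespace Iso

variable {D : PerfectMatchingGraph M F} {D' : PerfectMatchingGraph M' F'} (φ : D.Iso D')

/-- The bijection of the half-edges. -/
def onHalfEdge : M × Bool × Bool ≃ M' × Bool × Bool where
  toFun p := (φ.onEdge p.1, p.2.1, xor p.2.2 (φ.flip p.1))
  invFun p := (φ.onEdge.symm p.1, p.2.1, xor p.2.2 (φ.flip (φ.onEdge.symm p.1)))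
  left_inv p := by simp
  right_inv p := by simp

/-- The bijection of the points. -/
def onPoint : D.Point ≃ D'.Point := Equiv.sumCongr φ.onHalfEdge φ.onFree

/-- Corresponding states. -/
def StateRel (α : M → Bool) (α' : M' → Bool) : Prop := ∀ e, α' (φ.onEdge e) = α e

variable {φ}

theorem StateRel.arc {α : M → Bool} {α' : M' → Bool} (h : φ.StateRel α α') {p q : D.Point}
    (hpq : D.Arc α p q) : D'.Arc α' (φ.onPoint p) (φ.onPoint q) := by
  rcases hpq with p | ⟨e, b⟩
  · have := Arc.join (D := D') (α := α') (φ.onHalfEdge p)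
    rw [show D'.join (φ.onHalfEdge p) = φ.onHalfEdge (D.join p) from φ.map_join p _ rfl] at this
    exact this
  · have := Arc.smoothing (D := D') (α := α') (φ.onEdge e) (xor b (φ.flip e))
    rw [h e, Bool.xor_right_comm] at this
    exact this

theorem StateRel.arc_symm {α : M → Bool} {α' : M' → Bool} (h : φ.StateRel α α') {p q : D'.Point}
    (hpq : D'.Arc α' p q) : D.Arc α (φ.onPoint.symm p) (φ.onPoint.symm q) := by
  rcases hpq with p | ⟨e, b⟩
  · have := Arc.join (D := D) (α := α) (φ.onHalfEdge.symm p)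
    rw [show D.join (φ.onHalfEdge.symm p) = φ.onHalfEdge.symm (D'.join p) by
      rw [Equiv.eq_symm_apply]
      refine (φ.map_join _ _ rfl).symm.trans (congrArg D'.join ?_)
      exact φ.onHalfEdge.apply_symm_apply p] at this
    exact this
  · have := Arc.smoothing (D := D) (α := α) (φ.onEdge.symm e) (xor b (φ.flip (φ.onEdge.symm e)))
    rw [← h, Bool.xor_right_comm, Equiv.apply_symm_apply] at this
    exact this

/-- The bijection of the circles of corresponding states. -/
def StateRel.onCircle {α : M → Bool} {α' : M' → Bool} (h : φ.StateRel α α') :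
    D.Circle α ≃ D'.Circle α' :=
  Quot.congr φ.onPoint fun p q => ⟨h.arc, fun hpq => by simpa using h.arc_symm hpq⟩

theorem StateRel.onCircle_circ {α : M → Bool} {α' : M' → Bool} (h : φ.StateRel α α')
    (p : D.Point) : h.onCircle (D.circ α p) = D'.circ α' (φ.onPoint p) := rfl

theorem StateRel.circ_eq_iff {α : M → Bool} {α' : M' → Bool} (h : φ.StateRel α α')
    (p q : D.Point) : D'.circ α' (φ.onPoint p) = D'.circ α' (φ.onPoint q) ↔
      D.circ α p = D.circ α q := by
  rw [← h.onCircle_circ, ← h.onCircle_circ, h.onCircle.apply_eq_iff_eq]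

variable (φ)

/-- Corresponding monomials. -/
def MonomialRel {n : ℕ} (x : D.Monomial n) (x' : D'.Monomial n) : Prop :=
  φ.StateRel x.1 x'.1 ∧ ∀ p, x'.2 (D'.circ x'.1 (φ.onPoint p)) = x.2 (D.circ x.1 p)

variable {φ}

theorem MonomialRel.unique_left {n : ℕ} {x y : D.Monomial n} {z : D'.Monomial n}
    (hx : φ.MonomialRel x z) (hy : φ.MonomialRel y z) : x = y := by
  obtain ⟨α, a⟩ := x
  obtain ⟨β, b⟩ := y
  obtain rfl : α = β := funext fun e => (hx.1 e).symm.trans (hy.1 e)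
  congr 1
  funext c
  rw [← D.circ_out α c]
  exact (hx.2 _).symm.trans (hy.2 _)

theorem MonomialRel.unique_right {n : ℕ} {z : D.Monomial n} {x y : D'.Monomial n}
    (hx : φ.MonomialRel z x) (hy : φ.MonomialRel z y) : x = y := by
  obtain ⟨α, a⟩ := x
  obtain ⟨β, b⟩ := y
  obtain rfl : α = β := by
    funext e
    obtain ⟨e, rfl⟩ := φ.onEdge.surjective e
    exact (hx.1 e).trans (hy.1 e).symm
  congr 1
  funext c
  obtain ⟨p, hp⟩ := φ.onPoint.surjective c.out
  rw [← D'.circ_out α c, ← hp]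
  exact (hx.2 _).trans (hy.2 _).symm

theorem StateRel.monomialRel {n : ℕ} {α : M → Bool} {α' : M' → Bool} (h : φ.StateRel α α')
    (a : D.Circle α → Fin n) : φ.MonomialRel ⟨α, a⟩ ⟨α', a ∘ h.onCircle.symm⟩ := by
  refine ⟨h, fun p => ?_⟩
  simp only [Function.comp_apply]
  rw [← h.onCircle_circ, Equiv.symm_apply_apply]

theorem StateRel.monomialRel_symm {n : ℕ} {α : M → Bool} {α' : M' → Bool} (h : φ.StateRel α α')
    (a : D'.Circle α' → Fin n) : φ.MonomialRel ⟨α, a ∘ h.onCircle⟩ ⟨α', a⟩ :=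
  ⟨h, fun _ => rfl⟩

theorem exists_onMonomial (φ : D.Iso D') (n : ℕ) :
    ∃ B : D.Monomial n ≃ D'.Monomial n, ∀ x, φ.MonomialRel x (B x) := by
  have h : ∀ α, φ.StateRel α (α ∘ φ.onEdge.symm) := fun α e => by simp
  set B : D.Monomial n → D'.Monomial n := fun x =>
    ⟨x.1 ∘ φ.onEdge.symm, x.2 ∘ (h x.1).onCircle.symm⟩
  have hrel : ∀ x, φ.MonomialRel x (B x) := fun x => (h x.1).monomialRel x.2
  refine ⟨Equiv.ofBijective B ⟨fun x y hxy => ?_, fun z => ?_⟩, hrel⟩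
  · refine (hrel x).unique_left ?_
    rw [hxy]
    exact hrel y
  · have h' : φ.StateRel (z.1 ∘ φ.onEdge) z.1 := fun e => rfl
    exact ⟨⟨z.1 ∘ φ.onEdge, z.2 ∘ h'.onCircle⟩, (hrel _).unique_right (h'.monomialRel_symm z.2)⟩

theorem MonomialRel.degree_eq [Finite M] [Finite F] [Finite M'] [Finite F'] {n : ℕ}
    {x : D.Monomial n} {x' : D'.Monomial n} (h : φ.MonomialRel x x') :
    D'.degree x' = D.degree x := by
  let _ := Fintype.ofFinite (D.Circle x.1)
  let _ := Fintype.ofFinite (D'.Circle x'.1)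
  refine (Fintype.sum_equiv h.1.onCircle _ _ fun c => ?_).symm
  rw [← D.circ_out x.1 c, h.1.onCircle_circ, h.2]

open Classical in
theorem MonomialRel.edgeCoeff_eq [Finite M] {k : Type*} [CommRing k] {n : ℕ} (s : k)
    {x y : D.Monomial n} {x' y' : D'.Monomial n} (hx : φ.MonomialRel x x')
    (hy : φ.MonomialRel y y') (e : M) :
    D'.edgeCoeff s (φ.onEdge e) x' y' = D.edgeCoeff s e x y := by
  have hpt : ∀ b, (Sum.inl (φ.onEdge e, false, b) : D'.Point) =
      φ.onPoint (Sum.inl (e, false, xor b (φ.flip e))) := fun b => by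
    simp [onPoint, onHalfEdge]
  have hcond : (x'.1 (φ.onEdge e) = false ∧ y'.1 (φ.onEdge e) = true ∧
      (∀ e', e' ≠ φ.onEdge e → y'.1 e' = x'.1 e') ∧
      ∀ p, D'.circ x'.1 p ≠ D'.circ x'.1 (Sum.inl (φ.onEdge e, false, false)) →
        D'.circ x'.1 p ≠ D'.circ x'.1 (Sum.inl (φ.onEdge e, false, true)) →
          y'.2 (D'.circ y'.1 p) = x'.2 (D'.circ x'.1 p)) ↔
      (x.1 e = false ∧ y.1 e = true ∧ (∀ e', e' ≠ e → y.1 e' = x.1 e') ∧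
      ∀ p, D.circ x.1 p ≠ D.circ x.1 (Sum.inl (e, false, false)) →
        D.circ x.1 p ≠ D.circ x.1 (Sum.inl (e, false, true)) →
          y.2 (D.circ y.1 p) = x.2 (D.circ x.1 p)) := by
    rw [hx.1 e, hy.1 e, φ.onEdge.surjective.forall, φ.onPoint.surjective.forall]
    simp only [φ.onEdge.injective.ne_iff, hx.1 _, hy.1 _, hpt, ne_eq, hx.1.circ_eq_iff, hx.2, hy.2]
    cases φ.flip e
    · rfl
    · simp only [Bool.xor_true, Bool.not_false, Bool.not_true]
      refine and_congr_right fun _ => and_congr_right fun _ => and_congr_right fun _ => ?_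
      exact forall_congr' fun p => ⟨fun h h0 h1 => h h1 h0, fun h h0 h1 => h h1 h0⟩
  simp only [edgeCoeff]
  by_cases hc : x.1 e = false ∧ y.1 e = true ∧ (∀ e', e' ≠ e → y.1 e' = x.1 e') ∧
      ∀ p, D.circ x.1 p ≠ D.circ x.1 (Sum.inl (e, false, false)) →
        D.circ x.1 p ≠ D.circ x.1 (Sum.inl (e, false, true)) →
          y.2 (D.circ y.1 p) = x.2 (D.circ x.1 p)
  swap
  · rw [if_neg hc, if_neg (hcond.not.2 hc)]
  rw [if_pos hc, if_pos (hcond.2 hc)]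
  have htop := circ_eq_of_circ_ne (D := D) (e := e) hc.2.2.1 hc.1 hc.2.1
  simp only [hpt, ne_eq, hx.1.circ_eq_iff, hy.1.circ_eq_iff, hx.2, hy.2]
  cases φ.flip e
  · rfl
  · simp only [Bool.xor_true, Bool.not_false, Bool.not_true]
    by_cases h0 : D.circ x.1 (Sum.inl (e, false, false)) = D.circ x.1 (Sum.inl (e, false, true))
    · rw [if_neg (not_not.2 h0), if_neg (not_not.2 h0.symm)]
      by_cases h1 : D.circ y.1 (Sum.inl (e, false, false)) = D.circ y.1 (Sum.inl (e, false, true))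
      · rw [if_neg (not_not.2 h1), if_neg (not_not.2 h1.symm), h0, h1]
      · rw [if_pos h1, if_pos (Ne.symm h1), h0, comulCoeff, comulCoeff, Nat.add_comm]
    · rw [if_pos h0, if_pos (Ne.symm h0), htop h0, mulCoeff, mulCoeff, Nat.add_comm]

theorem edgeMap_comp [Finite M] [Finite F] [Finite M'] [Finite F'] {k : Type*} [CommRing k]
    {n : ℕ} (s : k) {B : D.Monomial n ≃ D'.Monomial n} (hB : ∀ x, φ.MonomialRel x (B x)) (e : M)
    (w : D'.Monomial n → k) :
    D.edgeMap n s e (w ∘ B) = D'.edgeMap n s (φ.onEdge e) w ∘ B := by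
  funext y
  change ∑ x, D.edgeCoeff s e x y * w (B x) =
    ∑ x, D'.edgeCoeff s (φ.onEdge e) x (B y) * w x
  refine Fintype.sum_equiv B _ _ fun x => ?_
  rw [(hB x).edgeCoeff_eq s (hB y) e]

end Iso

end PerfectMatchingGraph

namespace TrivalentRibbonGraph

open PerfectMatchingGraph

variable {V H L V' H' L' : Type} {Γ : TrivalentRibbonGraph V H L}
  {Γ' : TrivalentRibbonGraph V' H' L'}

/-- The isomorphism of bubbled blowups given by an equivalence of ribbon graphs. -/
def Equivalence.blowupIso (φ : Γ.Equivalence Γ') : Γ.bubbledBlowup.Iso Γ'.bubbledBlowup where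
  onEdge := φ.onHalf
  onFree := (φ.onLoop.prodCongr (Equiv.refl Bool)).subtypeEquiv fun c => by
    simp [φ.map_loopTwist]
  flip h := φ.flip (Γ.vert h)
  map_join := by
    rintro ⟨h, i, b⟩ _ rfl
    have hs : Γ.vert (Γ.rot.symm h) = Γ.vert h := by
      rw [← Γ.vert_rot (Γ.rot.symm h), Equiv.apply_symm_apply]
    cases i
    · cases hf : φ.flip (Γ.vert h)
      · have h1 := φ.map_rot h hf
        have h2 : Γ'.rot.symm (φ.onHalf h) = φ.onHalf (Γ.rot.symm h) := by
          rw [Equiv.symm_apply_eq, φ.map_rot _ (by rw [hs, hf]), Equiv.apply_symm_apply]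
        cases b <;> simp [bubbledBlowup, bubbleJoin, hs, Γ.vert_rot, hf, h1, h2]
      · have h1 : Γ'.rot.symm (φ.onHalf h) = φ.onHalf (Γ.rot h) := by
          rw [Equiv.symm_apply_eq, φ.map_rot_flip h hf]
        have h2 : Γ'.rot (φ.onHalf h) = φ.onHalf (Γ.rot.symm h) := by
          have := φ.map_rot_flip (Γ.rot.symm h) (by rw [hs, hf])
          rwa [Equiv.apply_symm_apply] at this
        cases b <;> simp [bubbledBlowup, bubbleJoin, hs, Γ.vert_rot, hf, h1, h2]
    · simp only [bubbledBlowup, bubbleJoin, φ.map_opp, φ.map_twist]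
      cases b <;> cases Γ.twist h <;> cases φ.flip (Γ.vert h) <;>
        cases φ.flip (Γ.vert (Γ.opp h)) <;> rfl

theorem Equivalence.stateRel (φ : Γ.Equivalence Γ') {ν : V → Bool} {ν' : V' → Bool}
    (h : ∀ v, ν' (φ.onVert v) = ν v) :
    φ.blowupIso.StateRel (Γ.blowupState ν) (Γ'.blowupState ν') := fun a => by
  change ν' (Γ'.vert (φ.onHalf a)) = ν (Γ.vert a)
  rw [φ.map_vert, h]

theorem Equivalence.exists_onMonomial (φ : Γ.Equivalence Γ') (n : ℕ) :
    ∃ B : Γ.VertexMonomial n ≃ Γ'.VertexMonomial n, ∀ x, (B x).1 = x.1 ∘ φ.onVert.symm ∧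
      φ.blowupIso.MonomialRel (Γ.toBlowup n x) (Γ'.toBlowup n (B x)) := by
  have h : ∀ ν : V → Bool, φ.blowupIso.StateRel (Γ.blowupState ν)
      (Γ'.blowupState (ν ∘ φ.onVert.symm)) := fun ν => φ.stateRel fun v => by simp
  set B : Γ.VertexMonomial n → Γ'.VertexMonomial n := fun x =>
    ⟨x.1 ∘ φ.onVert.symm, x.2 ∘ (h x.1).onCircle.symm⟩
  have hrel : ∀ x, φ.blowupIso.MonomialRel (Γ.toBlowup n x) (Γ'.toBlowup n (B x)) :=
    fun x => (h x.1).monomialRel x.2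
  refine ⟨Equiv.ofBijective B ⟨fun x y hxy => ?_, fun z => ?_⟩, fun x => ⟨rfl, hrel x⟩⟩
  · refine Γ.toBlowup_injective n ((hrel x).unique_left ?_)
    rw [hxy]
    exact hrel y
  · have h' : φ.blowupIso.StateRel (Γ.blowupState (z.1 ∘ φ.onVert)) (Γ'.blowupState z.1) :=
      φ.stateRel fun v => rfl
    exact ⟨⟨z.1 ∘ φ.onVert, z.2 ∘ h'.onCircle⟩, Γ'.toBlowup_injective n
      ((hrel _).unique_right (h'.monomialRel_symm z.2))⟩

variable [Finite H] [Finite L] [Finite H'] [Finite L'] {k : Type*} [CommRing k] {n : ℕ}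

theorem Equivalence.vertexMap_comp (φ : Γ.Equivalence Γ') (hn : 0 < n) {s : k} (hs : s ^ 2 = n)
    {B : Γ.VertexMonomial n ≃ Γ'.VertexMonomial n}
    (hB : ∀ x, φ.blowupIso.MonomialRel (Γ.toBlowup n x) (Γ'.toBlowup n (B x))) (v : V)
    (w : Γ'.VertexMonomial n → k) :
    Γ.vertexMap n s v (w ∘ B) = Γ'.vertexMap n s (φ.onVert v) w ∘ B := by
  obtain ⟨C, hC⟩ := φ.blowupIso.exists_onMonomial n
  have hBC : ∀ x, C (Γ.toBlowup n x) = Γ'.toBlowup n (B x) :=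
    fun x => (hC _).unique_right (hB x)
  have hext : Function.extend (Γ.toBlowup n) (w ∘ B) 0 =
      Function.extend (Γ'.toBlowup n) w 0 ∘ C := by
    funext y
    rw [Function.comp_apply]
    by_cases hy : ∃ x, Γ.toBlowup n x = y
    · obtain ⟨x, rfl⟩ := hy
      rw [(Γ.toBlowup_injective n).extend_apply, hBC, (Γ'.toBlowup_injective n).extend_apply]
      rfl
    · rw [Function.extend_apply' _ _ _ hy, Function.extend_apply']
      · rfl
      · rintro ⟨z, hz⟩
        obtain ⟨x, rfl⟩ := B.surjective z
        rw [← hBC] at hz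
        exact hy ⟨x, C.injective hz⟩
  have hv := (Γ.exists_vert_eq v).choose_spec
  obtain ⟨h1, h2, -⟩ := Γ.rot_ne (Γ.exists_vert_eq v).choose
  rw [← Γ'.threeStep_eq_vertexMap hn hs (v := φ.onVert v)
    (h₁ := φ.onHalf (Γ.exists_vert_eq v).choose)
    (h₂ := φ.onHalf (Γ.rot (Γ.exists_vert_eq v).choose))
    (h₃ := φ.onHalf (Γ.rot (Γ.rot (Γ.exists_vert_eq v).choose)))
    (by rw [φ.map_vert, hv]) (by rw [φ.map_vert, vert_rot, hv])
    (by rw [φ.map_vert, vert_rot, vert_rot, hv]) (φ.onHalf.injective.ne h1.symm)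
    (φ.onHalf.injective.ne h2.symm)
    (φ.onHalf.injective.ne fun h' => h1 (Γ.rot.injective h'.symm))]
  funext y
  change Γ.threeStep n s _ _ _ (w ∘ B) y = _
  rw [Function.comp_apply, threeStep_apply, threeStep_apply, hext, ← hBC]
  simp only [blowupThreeStep, LinearMap.comp_apply]
  rw [PerfectMatchingGraph.Iso.edgeMap_comp s hC, PerfectMatchingGraph.Iso.edgeMap_comp s hC,
    PerfectMatchingGraph.Iso.edgeMap_comp s hC]
  rfl

section Sign

variable [Fintype V] {N N' : ℕ}

open Classical in
theorem edgeSign_eq_prod (o : V ≃ Fin N) (ν : V → Bool) (v : V) :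
    edgeSign o ν v = ∏ u, if o u < o v ∧ ν u = true then -1 else 1 := by
  rw [edgeSign, Nat.card_eq_fintype_card, Fintype.card_subtype, Finset.prod_ite]
  simp

theorem edgeSign_mul_self (o : V ≃ Fin N) (ν : V → Bool) (v : V) :
    edgeSign o ν v * edgeSign o ν v = 1 := by
  rw [edgeSign, ← mul_pow]
  simp

open Classical in
/-- The sign comparing two numberings of the vertices: the parity of the number of inversions
among the vertices with a `1`-smoothing. -/
noncomputable def inversionSign (o : V ≃ Fin N) (o' : V ≃ Fin N') (ν : V → Bool) : ℤ :=
  ∏ u, ∏ v, if ν u = true ∧ ν v = true ∧ o u < o v ∧ o' v < o' u then -1 else 1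

theorem inversionSign_mul_self (o : V ≃ Fin N) (o' : V ≃ Fin N') (ν : V → Bool) :
    inversionSign o o' ν * inversionSign o o' ν = 1 := by
  rw [inversionSign, ← Finset.prod_mul_distrib]
  refine Finset.prod_eq_one fun u _ => ?_
  rw [← Finset.prod_mul_distrib]
  refine Finset.prod_eq_one fun v _ => ?_
  split_ifs <;> rfl

open Classical in
theorem inversionSign_update (o : V ≃ Fin N) (o' : V ≃ Fin N') {ν : V → Bool} {v : V}
    (h : ν v = false) : inversionSign o o' (Function.update ν v true) =
      inversionSign o o' ν * (edgeSign o ν v * edgeSign o' ν v) := by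
  have hfac : ∀ a b, (if Function.update ν v true a = true ∧ Function.update ν v true b = true ∧
      o a < o b ∧ o' b < o' a then -1 else 1 : ℤ) =
      (if ν a = true ∧ ν b = true ∧ o a < o b ∧ o' b < o' a then -1 else 1) *
      ((if a = v then if ν b = true ∧ o v < o b ∧ o' b < o' v then -1 else 1 else 1) *
      (if b = v then if ν a = true ∧ o a < o v ∧ o' v < o' a then -1 else 1 else 1)) := by
    intro a b
    by_cases ha : a = v
    · subst ha
      by_cases hb : b = a
      · subst hb
        simp [h]
      · simp [hb, h]
    · by_cases hb : b = v
      · subst hb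
        simp [ha, h]
      · simp [ha, hb]
  rw [inversionSign, inversionSign]
  simp only [hfac, Finset.prod_mul_distrib]
  congr 1
  simp only [Finset.prod_ite_eq', Finset.mem_univ, if_true]
  have hrow : ∏ a, ∏ b, (if a = v then if ν b = true ∧ o v < o b ∧ o' b < o' v then -1 else 1
      else 1 : ℤ) = ∏ b, if ν b = true ∧ o v < o b ∧ o' b < o' v then -1 else 1 := by
    rw [Finset.prod_comm]
    simp
  rw [hrow, edgeSign_eq_prod, edgeSign_eq_prod, ← Finset.prod_mul_distrib,
    ← Finset.prod_mul_distrib]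
  refine Finset.prod_congr rfl fun u _ => ?_
  cases hu : ν u
  · simp
  · have huv : u ≠ v := by
      rintro rfl
      simp [h] at hu
    have h1 : o u ≠ o v := o.injective.ne huv
    have h2 : o' u ≠ o' v := o'.injective.ne huv
    rcases lt_or_gt_of_ne h1 with h1 | h1 <;> rcases lt_or_gt_of_ne h2 with h2 | h2 <;>
      simp [h1, h2, h1.not_gt, h2.not_gt]

end Sign

end TrivalentRibbonGraph

/-! ## Additive ranks -/

section AdditiveRank

universe u w

variable {k : Type u} [CommRing k]

theorem IsFiniteFreeSubquotient.submodule {M : Type*} [AddCommGroup M] [Module k M]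
    (h : IsFiniteFreeSubquotient k M) (P : Submodule k M) : IsFiniteFreeSubquotient k P := by
  obtain ⟨r, N, f, hf⟩ := h
  refine ⟨r, (P.comap f).map N.subtype, LinearMap.restrict f (p := P.comap f) (q := P)
    (fun x hx => hx) ∘ₗ (N.equivSubtypeMap (P.comap f)).symm.toLinearMap, ?_⟩
  rw [LinearMap.coe_comp]
  refine Function.Surjective.comp ?_ (LinearEquiv.surjective _)
  rintro ⟨y, hy⟩
  obtain ⟨x, rfl⟩ := hf y
  exact ⟨⟨x, hy⟩, rfl⟩

theorem IsFiniteFreeSubquotient.of_surjective {M M' : Type*} [AddCommGroup M] [Module k M]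
    [AddCommGroup M'] [Module k M'] (h : IsFiniteFreeSubquotient k M) (f : M →ₗ[k] M')
    (hf : Function.Surjective f) : IsFiniteFreeSubquotient k M' := by
  obtain ⟨r, N, g, hg⟩ := h
  exact ⟨r, N, f ∘ₗ g, hf.comp hg⟩

theorem isFiniteFreeSubquotient_pi (c : ℕ) : IsFiniteFreeSubquotient k (Fin c → k) :=
  ⟨c, ⊤, Submodule.subtype ⊤, fun x => ⟨⟨x, trivial⟩, rfl⟩⟩

namespace AdditiveRank

variable {A : Type w} [AddCommGroup A] (r : AdditiveRank k A)

theorem rank_of_subsingleton (M : Type u) [AddCommGroup M] [Module k M] [Subsingleton M] :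
    r.rank M = 0 := by
  have h := r.additive M M M LinearMap.id 0 Function.injective_id
    (fun x => ⟨fun _ => ⟨x, rfl⟩, fun _ => Subsingleton.elim _ _⟩)
    (fun x => ⟨0, Subsingleton.elim _ _⟩)
    ⟨0, ⊤, 0, fun x => ⟨0, Subsingleton.elim _ _⟩⟩
  simpa using h

theorem rank_congr {M M' : Type u} [AddCommGroup M] [Module k M] [AddCommGroup M'] [Module k M']
    (h : IsFiniteFreeSubquotient k M') (e : M ≃ₗ[k] M') : r.rank M' = r.rank M := by
  have := r.additive M M' PUnit.{u + 1} e.toLinearMap 0 e.injective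
    (fun x => ⟨fun _ => e.surjective x, fun _ => rfl⟩) (fun x => ⟨0, rfl⟩) h
  rwa [r.rank_of_subsingleton PUnit, add_zero] at this

theorem rank_pi (c : ℕ) : r.rank (Fin c → k) = c • r.rank k := by
  induction c with
  | zero => rw [r.rank_of_subsingleton, zero_smul]
  | succ c ih =>
    rw [r.additive k (Fin (c + 1) → k) (Fin c → k) (LinearMap.single k (fun _ => k) 0)
      (LinearMap.funLeft k k Fin.succ) (Pi.single_injective (M := fun _ => k) 0) ?_
      (LinearMap.funLeft_surjective_of_injective _ _ _ (Fin.succ_injective c))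
      (isFiniteFreeSubquotient_pi _), ih, succ_nsmul']
    intro x
    constructor
    · intro hx
      refine ⟨x 0, funext fun i => ?_⟩
      refine Fin.cases ?_ (fun i => ?_) i
      · simp
      · have := congrFun hx i
        simpa using this.symm
    · rintro ⟨a, rfl⟩
      funext i
      simp

theorem rank_quotient {M : Type u} [AddCommGroup M] [Module k M]
    (h : IsFiniteFreeSubquotient k M) (P : Submodule k M) :
    r.rank M = r.rank P + r.rank (M ⧸ P) :=
  r.additive P M (M ⧸ P) P.subtype P.mkQ P.injective_subtype (LinearMap.exact_subtype_mkQ P)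
    P.mkQ_surjective h

/-- The usual rank over an integral domain. -/
noncomputable def finrank (k : Type u) [CommRing k] [IsDomain k] : AdditiveRank k ℤ where
  rank M := Module.finrank k M
  additive M₁ M₂ M₃ _ _ _ _ _ _ f g hf hfg hg h := by
    have hlt : Module.rank k M₂ < Cardinal.aleph0 := by
      obtain ⟨r, N, p, hp⟩ := h
      have h1 := LinearMap.rank_le_of_surjective p hp
      have h2 : Module.rank k N ≤ r := by simpa using N.rank_le
      exact (h1.trans h2).trans_lt (Cardinal.natCast_lt_aleph0)
    have hrn := LinearMap.rank_range_add_rank_ker g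
    have h1 : Module.rank k (LinearMap.ker g) = Module.rank k M₁ := by
      rw [LinearMap.exact_iff.1 hfg]
      exact rank_range_of_injective f hf
    have h3 : Module.rank k (LinearMap.range g) = Module.rank k M₃ := by
      rw [LinearMap.range_eq_top.2 hg, rank_top]
    rw [h1, h3] at hrn
    have hlt3 : Module.rank k M₃ < Cardinal.aleph0 := lt_of_le_of_lt (by
      rw [← hrn]
      exact self_le_add_right _ _) hlt
    have hlt1 : Module.rank k M₁ < Cardinal.aleph0 := lt_of_le_of_lt (by
      rw [← hrn]
      exact self_le_add_left _ _) hlt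
    simp only [Module.finrank]
    rw [← hrn, Cardinal.toNat_add hlt3 hlt1, Nat.cast_add, add_comm]

end AdditiveRank

theorem sum_range_alternating {A : Type*} [AddCommGroup A] (b : ℕ → A) (N : ℕ) :
    ∑ i ∈ Finset.range N, (-1 : ℤ) ^ i • (b i + b (i + 1)) = b 0 - (-1 : ℤ) ^ N • b N := by
  induction N with
  | zero => simp
  | succ N ih =>
    rw [Finset.sum_range_succ, ih, pow_succ, smul_add, mul_neg_one, neg_smul]
    abel

end AdditiveRank

theorem LaurentPolynomial.prod_T {R ι : Type*} [CommSemiring R] (t : Finset ι)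
    (f : ι → ℤ) : ∏ i ∈ t, (LaurentPolynomial.T (f i) : R[T;T⁻¹]) =
      LaurentPolynomial.T (∑ i ∈ t, f i) := by
  classical
  induction t using Finset.induction_on with
  | empty => simp
  | insert a t ha ih => rw [Finset.prod_insert ha, Finset.sum_insert ha, ih, LaurentPolynomial.T_add]

namespace TrivalentRibbonGraph

open PerfectMatchingGraph

section Invariance

variable {V H L V' H' L' : Type} {Γ : TrivalentRibbonGraph V H L}
  {Γ' : TrivalentRibbonGraph V' H' L'} [Fintype V] [Finite H] [Finite L] [Fintype V'] [Finite H']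
  [Finite L'] {k : Type*} [CommRing k] {n : ℕ}

/-- Isomorphic bigraded complexes have isomorphic homology. -/
theorem nonempty_VCH_equiv (s : k) {N N' : ℕ} (o : V ≃ Fin N) (o' : V' ≃ Fin N')
    (Φ : (Γ'.VertexMonomial n → k) ≃ₗ[k] (Γ.VertexMonomial n → k))
    (hΦ : ∀ i j w, Φ w ∈ Γ.chain n k i j ↔ w ∈ Γ'.chain n k i j)
    (hδ : ∀ w, Γ.differential n s o (Φ w) = Φ (Γ'.differential n s o' w)) (i j : ℤ) :
    Nonempty (Γ.VCH n s o i j ≃ₗ[k] Γ'.VCH n s o' i j) := by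
  have hZ : (Γ'.cocycles n s o' i j).map (Φ : _ →ₗ[k] _) = Γ.cocycles n s o i j := by
    ext w
    obtain ⟨w, rfl⟩ := Φ.surjective w
    rw [Submodule.mem_map_equiv, LinearEquiv.symm_apply_apply, cocycles, cocycles,
      Submodule.mem_inf, Submodule.mem_inf, hΦ, LinearMap.mem_ker, LinearMap.mem_ker, hδ,
      LinearEquiv.map_eq_zero_iff]
  have hB : ∀ w, Φ w ∈ Γ.coboundaries n s o i j ↔ w ∈ Γ'.coboundaries n s o' i j := by
    intro w
    rw [coboundaries, coboundaries, Submodule.mem_map, Submodule.mem_map, Φ.surjective.exists]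
    simp only [hΦ, hδ, Φ.injective.eq_iff]
  refine ⟨(Submodule.Quotient.equiv _ _ (LinearEquiv.ofSubmodules Φ _ _ hZ) ?_).symm⟩
  ext w
  obtain ⟨w, rfl⟩ := (LinearEquiv.ofSubmodules Φ _ _ hZ).surjective w
  rw [Submodule.mem_map_equiv, LinearEquiv.symm_apply_apply]
  exact (hB w.1).symm

theorem Equivalence.nonempty_VCH_equiv (φ : Γ.Equivalence Γ') (hn : 0 < n) {s : k}
    (hs : s ^ 2 = n) {N N' : ℕ} (o : V ≃ Fin N) (o' : V' ≃ Fin N') (i j : ℤ) :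
    Nonempty (Γ.VCH n s o i j ≃ₗ[k] Γ'.VCH n s o' i j) := by
  classical
  obtain ⟨B, hB⟩ := φ.exists_onMonomial n
  set ε := inversionSign o (φ.onVert.trans o') with hε
  have hinv : Function.Involutive (Γ.scale k n ε) := fun w => by
    funext x
    rw [scale_apply, scale_apply, smul_smul, hε, inversionSign_mul_self, one_smul]
  have hdeg : ∀ x, Γ'.homDegree (B x) = Γ.homDegree x ∧ Γ'.qDegree (B x) = Γ.qDegree x := by
    intro x
    have hw : weight (B x).1 = weight x.1 := by
      rw [(hB x).1]
      exact (Nat.card_congr (φ.onVert.subtypeEquiv fun v => by simp)).symm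
    rw [homDegree, homDegree, qDegree_eq, qDegree_eq, hw, (hB x).2.degree_eq]
    exact ⟨rfl, rfl⟩
  have hsq : ∀ ν, ε ν * ε ν = 1 := inversionSign_mul_self _ _
  set Φ := (LinearEquiv.funCongrLeft k k B).trans (LinearEquiv.ofInvolutive _ hinv)
  have hΦ : ∀ w, Φ w = Γ.scale k n ε (w ∘ B) := fun w => rfl
  refine TrivalentRibbonGraph.nonempty_VCH_equiv s o o' Φ (fun i j w => ?_) (fun w => ?_) i j
  · have h0 : ∀ x, Φ w x = 0 ↔ w (B x) = 0 := by
      intro x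
      rw [hΦ, scale_apply]
      constructor
      · intro h
        have := congrArg (fun a => ε x.1 • a) h
        simpa only [smul_smul, hsq, one_smul, smul_zero, Function.comp_apply] using this
      · intro h
        rw [Function.comp_apply, h, smul_zero]
    change (∀ x, _ → Φ w x = 0) ↔ ∀ x, _ → w x = 0
    rw [B.surjective.forall]
    simp only [hdeg, h0]
  · rw [hΦ, hΦ, differential_apply, differential_apply]
    have hsum : (∑ v', Γ'.vertexMap n s v' (Γ'.scale k n (fun ν => edgeSign o' ν v') w)) ∘ B =
        ∑ v, Γ.vertexMap n s v ((Γ'.scale k n (fun ν => edgeSign o' ν (φ.onVert v)) w) ∘ B) := by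
      simp only [φ.vertexMap_comp hn hs fun x => (hB x).2]
      funext x
      rw [Function.comp_apply, Finset.sum_apply, Finset.sum_apply]
      exact (Fintype.sum_equiv φ.onVert _ _ fun v => rfl).symm
    rw [hsum, map_sum]
    refine Finset.sum_congr rfl fun v _ => ?_
    rw [Γ.scale_vertexMap s fun ν hν => inversionSign_update o (φ.onVert.trans o') hν]
    congr 1
    funext x
    have hsgn : edgeSign o' (B x).1 (φ.onVert v) = edgeSign (φ.onVert.trans o') x.1 v := by
      rw [edgeSign, edgeSign, (hB x).1]
      congr 1
      exact (Nat.card_congr (φ.onVert.subtypeEquiv fun v => by simp)).symm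
    simp only [scale_apply, Function.comp_apply, smul_smul, hsgn]
    congr 1
    rw [mul_assoc, mul_assoc, edgeSign_mul_self, mul_one, mul_comm]

end Invariance

section EulerCharacteristic

universe u w

variable {V H L : Type} (Γ : TrivalentRibbonGraph V H L) [Fintype V] [Finite H] [Finite L]
  {k : Type u} [CommRing k] (n : ℕ)

theorem exists_chain_equiv (k : Type*) [CommRing k] (i j : ℤ) : Nonempty (Γ.chain n k i j ≃ₗ[k]
    (Fin (Nat.card {x : Γ.VertexMonomial n // Γ.homDegree x = i ∧ Γ.qDegree x = j}) → k)) := by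
  classical
  refine ⟨(LinearEquiv.ofBijective ((LinearMap.funLeft k k (Subtype.val :
    {x : Γ.VertexMonomial n // Γ.homDegree x = i ∧ Γ.qDegree x = j} → _)).domRestrict _)
      ⟨?_, fun g => ?_⟩).trans (LinearEquiv.funCongrLeft k k (Finite.equivFin _).symm)⟩
  · rintro ⟨w, hw⟩ ⟨w', hw'⟩ h
    refine Subtype.ext (funext fun x => ?_)
    by_cases hx : Γ.homDegree x = i ∧ Γ.qDegree x = j
    · exact congrFun h ⟨x, hx⟩
    · exact (hw x hx).trans (hw' x hx).symm
  · refine ⟨⟨fun x => if h : Γ.homDegree x = i ∧ Γ.qDegree x = j then g ⟨x, h⟩ else 0,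
      fun x hx => dif_neg hx⟩, funext fun x => dif_pos x.2⟩

variable {n}

theorem coboundaries_le_cocycles (hn : 0 < n) {s : k} (hs : s ^ 2 = n) {N : ℕ} (o : V ≃ Fin N)
    (i j : ℤ) : Γ.coboundaries n s o i j ≤ Γ.cocycles n s o i j := by
  rw [coboundaries, Submodule.map_le_iff_le_comap]
  intro w hw
  refine ⟨?_, Γ.differential_differential o hn hs w⟩
  have := Γ.differential_mem_chain o s hw
  rwa [sub_add_cancel] at this

theorem weight_le {N : ℕ} (o : V ≃ Fin N) (ν : V → Bool) : weight ν ≤ N := by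
  have h := Nat.card_congr o
  rw [Nat.card_eq_fintype_card (α := Fin N), Fintype.card_fin] at h
  rw [← h]
  exact Nat.card_le_card_of_injective _ Subtype.val_injective

theorem chain_eq_bot {i : ℤ} {N : ℕ} (o : V ≃ Fin N) (hi : i < 0 ∨ N < i) (j : ℤ) :
    Γ.chain n k i j = ⊥ := by
  refine (Submodule.eq_bot_iff _).2 fun w hw => funext fun x => hw x ?_
  rintro ⟨h, -⟩
  have := weight_le o x.1
  rw [homDegree] at h
  omega

theorem sum_rank_VCH (hn : 0 < n) {s : k} (hs : s ^ 2 = n) {N : ℕ} (o : V ≃ Fin N) {A : Type w}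
    [AddCommGroup A] (r : AdditiveRank k A) (j : ℤ) :
    ∑ i ∈ Finset.range (N + 1), (-1 : ℤ) ^ i • r.rank (Γ.VCH n s o i j) =
      ∑ i ∈ Finset.range (N + 1), (-1 : ℤ) ^ i • r.rank (Γ.chain n k i j) := by
  have hC : ∀ i : ℤ, IsFiniteFreeSubquotient k (Γ.chain n k i j) := fun i => by
    obtain ⟨e⟩ := Γ.exists_chain_equiv n k i j
    exact (isFiniteFreeSubquotient_pi _).of_surjective e.symm.toLinearMap e.symm.surjective
  have hZ : ∀ i : ℤ, IsFiniteFreeSubquotient k (Γ.cocycles n s o i j) := fun i =>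
    ((hC i).submodule ((Γ.cocycles n s o i j).submoduleOf _)).of_surjective
      (Submodule.submoduleOfEquivOfLe inf_le_left).toLinearMap (LinearEquiv.surjective _)
  have hB : ∀ i : ℤ, IsFiniteFreeSubquotient k (Γ.coboundaries n s o i j) := fun i =>
    (hC (i - 1)).of_surjective _ (LinearMap.submoduleMap_surjective _ _)
  have h1 : ∀ i : ℕ, r.rank (Γ.chain n k i j) =
      r.rank (Γ.cocycles n s o i j) + r.rank (Γ.coboundaries n s o ((i + 1 : ℕ) : ℤ) j) := by
    intro i
    have hcob : Γ.coboundaries n s o ((i + 1 : ℕ) : ℤ) j =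
        (Γ.chain n k i j).map (Γ.differential n s o) := by
      rw [coboundaries, Nat.cast_add, Nat.cast_one, add_sub_cancel_right]
    rw [hcob]
    refine r.additive _ _ _ (Submodule.inclusion inf_le_left)
      ((Γ.differential n s o).submoduleMap _) (Submodule.inclusion_injective _) ?_
      (LinearMap.submoduleMap_surjective _ _) (hC i)
    rintro ⟨w, hw⟩
    constructor
    · intro h
      exact ⟨⟨w, hw, congrArg Subtype.val h⟩, rfl⟩
    · rintro ⟨⟨w', hw'⟩, h⟩
      obtain rfl : w' = w := congrArg Subtype.val h
      exact Subtype.ext hw'.2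
  have h2 : ∀ i : ℕ, r.rank (Γ.cocycles n s o i j) =
      r.rank (Γ.coboundaries n s o i j) + r.rank (Γ.VCH n s o i j) := by
    intro i
    rw [r.rank_quotient (hZ i) ((Γ.coboundaries n s o i j).submoduleOf (Γ.cocycles n s o i j)),
      r.rank_congr (hB i) (M := (Γ.coboundaries n s o i j).submoduleOf (Γ.cocycles n s o i j))
        (Submodule.submoduleOfEquivOfLe (Γ.coboundaries_le_cocycles hn hs o i j))]
  have hbot : r.rank (Γ.coboundaries n s o ((0 : ℕ) : ℤ) j) = 0 := by
    rw [coboundaries, Γ.chain_eq_bot o (by left; norm_num), Submodule.map_bot]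
    exact r.rank_of_subsingleton _
  have htop : r.rank (Γ.coboundaries n s o ((N + 1 : ℕ) : ℤ) j) = 0 := by
    have h := (Γ.coboundaries_le_cocycles hn hs o ((N + 1 : ℕ) : ℤ) j).trans inf_le_left
    rw [Γ.chain_eq_bot o (by right; push_cast; omega)] at h
    rw [le_bot_iff.1 h]
    exact r.rank_of_subsingleton _
  have h3 := sum_range_alternating (fun i : ℕ => r.rank (Γ.coboundaries n s o i j)) (N + 1)
  simp only [hbot, htop, smul_zero, sub_zero] at h3
  rw [← add_zero (∑ i ∈ Finset.range (N + 1), (-1 : ℤ) ^ i • r.rank (Γ.VCH n s o i j)), ← h3,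
    ← Finset.sum_add_distrib]
  refine Finset.sum_congr rfl fun i _ => ?_
  rw [h1, h2, ← smul_add]
  congr 1
  abel

open Classical in
theorem vertexPolynomial_eq_sum [Fintype (Γ.VertexMonomial n)] : Γ.vertexPolynomial n =
    ∑ x : Γ.VertexMonomial n, (-1 : ℤ) ^ weight x.1 • LaurentPolynomial.T (Γ.qDegree x) := by
  let _ := fun ν => Fintype.ofFinite (Γ.StateCircle ν)
  rw [vertexPolynomial, vertexBracket]
  trans ∑ ν : V → Bool, ∑ a : Γ.StateCircle ν → Fin n,
    (-1 : ℤ) ^ weight ν • (LaurentPolynomial.T (Γ.qDegree ⟨ν, a⟩) : ℤ[T;T⁻¹])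
  · refine Finset.sum_congr rfl fun ν _ => ?_
    rw [if_pos (by simp), Nat.card_eq_fintype_card (α := Γ.StateCircle ν), loopPolynomial,
      ← Fin.sum_univ_eq_sum_range (fun a => (LaurentPolynomial.T ((n / 2 : ℕ) - a : ℤ) : ℤ[T;T⁻¹])),
      ← Finset.card_univ, ← Finset.prod_const, Fintype.prod_sum, Finset.mul_sum]
    refine Finset.sum_congr rfl fun a _ => ?_
    have hw : Nat.card {v // (none : Option Bool) = none ∧ ν v = true} = weight ν := by
      simp [weight]
    rw [hw, LaurentPolynomial.prod_T, neg_pow, LaurentPolynomial.T_pow, mul_assoc,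
      ← LaurentPolynomial.T_add, zsmul_eq_mul]
    push_cast
    congr 2
    rw [add_comm, mul_comm (weight ν : ℤ)]
    rfl
  · have h := Fintype.sum_sigma' fun ν (a : Γ.StateCircle ν → Fin n) =>
      (-1 : ℤ) ^ weight ν • (LaurentPolynomial.T (Γ.qDegree ⟨ν, a⟩) : ℤ[T;T⁻¹])
    refine h.symm.trans ?_
    congr!

theorem sum_card_eq_coeff {N : ℕ} (o : V ≃ Fin N) (j : ℤ) :
    ∑ i ∈ Finset.range (N + 1), (-1 : ℤ) ^ i *
      (Nat.card {x : Γ.VertexMonomial n // Γ.homDegree x = i ∧ Γ.qDegree x = j} : ℤ) =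
      (Γ.vertexPolynomial n).coeff j := by
  classical
  have := Fintype.ofFinite (Γ.VertexMonomial n)
  have hcard : ∀ i : ℕ, (-1 : ℤ) ^ i *
      (Nat.card {x : Γ.VertexMonomial n // Γ.homDegree x = i ∧ Γ.qDegree x = j} : ℤ) =
      ∑ x : Γ.VertexMonomial n, if weight x.1 = i then
        (-1 : ℤ) ^ weight x.1 * (if Γ.qDegree x = j then 1 else 0) else 0 := by
    intro i
    rw [Nat.card_eq_fintype_card, Fintype.card_subtype, Finset.card_filter, Nat.cast_sum,
      Finset.mul_sum]
    refine Finset.sum_congr rfl fun x _ => ?_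
    rw [homDegree]
    by_cases h1 : weight x.1 = i <;> by_cases h2 : Γ.qDegree x = j <;> simp [h1, h2]
  simp only [hcard]
  rw [Finset.sum_comm, vertexPolynomial_eq_sum, AddMonoidAlgebra.coeff_sum, Finsupp.finsetSum_apply]
  refine Finset.sum_congr rfl fun x _ => ?_
  rw [Finset.sum_ite_eq, if_pos (Finset.mem_range.2 (Nat.lt_succ_of_le (weight_le o x.1))),
    AddMonoidAlgebra.coeff_smul, Finsupp.smul_apply, LaurentPolynomial.T_apply, smul_eq_mul]

theorem eulerCharacteristic (hn : 0 < n) {s : k} (hs : s ^ 2 = n) {N : ℕ} (o : V ≃ Fin N)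
    {A : Type w} [AddCommGroup A] (r : AdditiveRank k A) (j : ℤ) :
    ∑ i ∈ Finset.range (N + 1), (-1 : ℤ) ^ i • r.rank (Γ.VCH n s o i j) =
      (Γ.vertexPolynomial n).coeff j • r.rank k := by
  rw [Γ.sum_rank_VCH hn hs, ← Γ.sum_card_eq_coeff o, Finset.sum_smul]
  refine Finset.sum_congr rfl fun i _ => ?_
  obtain ⟨e⟩ := Γ.exists_chain_equiv n k i j
  rw [← r.rank_congr (isFiniteFreeSubquotient_pi _) e, r.rank_pi, mul_smul, natCast_zsmul]

end EulerCharacteristic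

end TrivalentRibbonGraph

theorem theorem1 {V H L : Type} [Fintype V] [Finite H] [Finite L]
    (Γ : TrivalentRibbonGraph V H L) (n : ℕ) (hn : 0 < n)
    {k : Type*} [CommRing k] (s : k) (hs : s ^ 2 = (n : k)) {N : ℕ} (o : V ≃ Fin N) :
    -- the three-step composites are independent of the order of the three steps
    (∀ (v : V) (h₁ h₂ h₃ : H), Γ.vert h₁ = v → Γ.vert h₂ = v → Γ.vert h₃ = v →
      h₁ ≠ h₂ → h₁ ≠ h₃ → h₂ ≠ h₃ → Γ.threeStep n s h₁ h₂ h₃ = Γ.vertexMap n s v) ∧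
    -- the differential has bidegree `(1, 0)` and square zero
    (∀ (i j : ℤ), ∀ w ∈ Γ.chain n k i j, Γ.differential n s o w ∈ Γ.chain n k (i + 1) j) ∧
    Γ.differential n s o ∘ₗ Γ.differential n s o = 0 ∧
    -- the homology depends neither on the numbering of the vertices nor on the presentation
    (∀ {V' H' L' : Type} [Fintype V'] [Finite H'] [Finite L']
      (Γ' : TrivalentRibbonGraph V' H' L') {N' : ℕ} (o' : V' ≃ Fin N'),
      Nonempty (Γ.Equivalence Γ') →
        ∀ i j : ℤ, Nonempty (Γ.VCH n s o i j ≃ₗ[k] Γ'.VCH n s o' i j)) ∧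
    -- over a domain, the graded Euler characteristic, coefficient by coefficient
    (IsDomain k → ∀ j : ℤ,
      ∑ i ∈ Finset.range (N + 1), (-1 : ℤ) ^ i * (Module.finrank k (Γ.VCH n s o i j) : ℤ) =
        (Γ.vertexPolynomial n).coeff j) ∧
    -- over any ring, the graded Euler characteristic with respect to any additive rank
    (∀ {A : Type*} [AddCommGroup A] (r : AdditiveRank k A) (j : ℤ),
      ∑ i ∈ Finset.range (N + 1), (-1 : ℤ) ^ i • r.rank (Γ.VCH n s o i j) =
        (Γ.vertexPolynomial n).coeff j • r.rank k) := by
  refine ⟨fun v h₁ h₂ h₃ hv₁ hv₂ hv₃ h12 h13 h23 =>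
      Γ.threeStep_eq_vertexMap hn hs hv₁ hv₂ hv₃ h12 h13 h23,
    fun i j w hw => Γ.differential_mem_chain o s hw,
    LinearMap.ext fun w => Γ.differential_differential o hn hs w,
    fun Γ' N' o' ⟨φ⟩ i j => φ.nonempty_VCH_equiv hn hs o o' i j,
    fun _ j => ?_, fun r j => Γ.eulerCharacteristic hn hs o r j⟩
  have h := Γ.eulerCharacteristic hn hs o (AdditiveRank.finrank k) j
  simpa [AdditiveRank.finrank] using h
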